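/- Notation. For a real random variable $U$ with a $C^\infty$ density $p$ on $\mathbb R$, let $\rho_U=p'/p$ be its score function and $J(U)=\mathbb E\,\rho_U(U)^2$ its Fisher information. For random variables $X,Y$ on one probability space and $\beta\in[0,1]$, let $\widetilde\rho$ be the score function of $\sqrt\beta X+\sqrt{1-\beta}\,Y$ and $$\Delta(X,Y,\beta)=\mathbb E\Big(\sqrt\beta\,\rho_X(X)+\sqrt{1-\beta}\,\rho_Y(Y)-\widetilde\rho\big(\sqrt\beta X+\sqrt{1-\beta}\,Y\big)\Big)^2 .$$ For random variables $S,T$ let $\alpha(S,T)=\sup_{A,B}\big|\mathbb P(S\in A,\,T\in B)-\mathbb P(S\in A)\,\mathbb P(T\in B)\big|$, the supremum being over Borel sets $A,B\subseteq\mathbb R$. Theorem 2.2. Let $K\in\mathbb R$, $\tau>0$ and $\varepsilon>0$. There is a constant $C=C(K,\tau,\varepsilon)$ such that the following holds. Let $S,T$ be (possibly dependent) real random variables with finite variances and $\max(\operatorname{Var}S,\operatorname{Var}T)\le K\tau$, let $Z_S,Z_T$ be $N(0,\tau)$ random variables that are independent of each other, with $(Z_S,Z_T)$ independent of $(S,T)$,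 and put $X=S+Z_S$, $Y=T+Z_T$. Then, for every $\beta\in[0,1]$, the variables $X$, $Y$ and $\sqrt\beta X+\sqrt{1-\beta}\,Y$ have $C^\infty$ densities and finite Fisher informations, the expectation that defines $\Delta(X,Y,\beta)$ is finite, and $$\beta J(X)+(1-\beta)J(Y)-J\big(\sqrt\beta X+\sqrt{1-\beta}\,Y\big)+C\,\alpha(S,T)^{1/3-\varepsilon}\ \ge\ \Delta(X,Y,\beta).$$ Moreover, for all real $k\ge 2$ and $M$ there is a constant $C=C(K,\tau,\varepsilon,k,M)$ such that, if in addition $\mathbb E|S|^k\le M$ and $\mathbb E|T|^k\le M$, then the same conclusion holds with $\alpha(S,T)^{k/(k+4)-\varepsilon}$ in place of $\alpha(S,T)^{1/3-\varepsilon}$. (For large $\varepsilon$ the exponent may be non-positive; then $0^0=1$ and $0^s=0$ for $s<0$.) -/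

import Mathlib

open MeasureTheory ProbabilityTheory
open scoped NNReal ENNReal

noncomputable section

/-- `p` is a smooth (infinitely differentiable) probability density on `ℝ` of the real random
variable `U` under `μ`. -/
structure HasSmoothDensity {Ω : Type*} [MeasurableSpace Ω] (μ : Measure Ω) (U : Ω → ℝ)
    (p : ℝ → ℝ) : Prop where
  aemeasurable : AEMeasurable U μ
  smooth : ContDiff ℝ ((⊤ : ℕ∞) : WithTop ℕ∞) p
  nonneg : ∀ x, 0 ≤ p x
  map_eq : μ.map U = (volume : Measure ℝ).withDensity (fun x => ENNReal.ofReal (p x))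

/-- A random variable has at most one smooth density. -/
theorem HasSmoothDensity.unique {Ω : Type*} [MeasurableSpace Ω] {μ : Measure Ω}
    [IsFiniteMeasure μ] {U : Ω → ℝ} {p q : ℝ → ℝ}
    (hp : HasSmoothDensity μ U p) (hq : HasSmoothDensity μ U q) : p = q := by
  have mp : Measurable (fun x => ENNReal.ofReal (p x)) :=
    hp.smooth.continuous.measurable.ennreal_ofReal
  have mq : Measurable (fun x => ENNReal.ofReal (q x)) :=
    hq.smooth.continuous.measurable.ennreal_ofReal
  have h : (fun x => ENNReal.ofReal (p x)) =ᵐ[volume] (fun x => ENNReal.ofReal (q x)) :=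
    (withDensity_eq_iff_of_sigmaFinite mp.aemeasurable mq.aemeasurable).1
      (hp.map_eq.symm.trans hq.map_eq)
  refine (Continuous.ae_eq_iff_eq (volume : Measure ℝ) hp.smooth.continuous
    hq.smooth.continuous).1 ?_
  filter_upwards [h] with x hx
  exact (ENNReal.ofReal_eq_ofReal_iff (hp.nonneg x) (hq.nonneg x)).1 hx

open Classical in
/-- The smooth density of `U` under `μ` (and `0` if `U` has none). -/
def smoothDensity {Ω : Type*} [MeasurableSpace Ω] (μ : Measure Ω) (U : Ω → ℝ) : ℝ → ℝ :=
  if h : ∃ p, HasSmoothDensity μ U p then h.choose else 0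

theorem HasSmoothDensity.smoothDensity_eq {Ω : Type*} [MeasurableSpace Ω] {μ : Measure Ω}
    [IsFiniteMeasure μ] {U : Ω → ℝ} {p : ℝ → ℝ} (hp : HasSmoothDensity μ U p) :
    smoothDensity μ U = p := by
  have h : ∃ p, HasSmoothDensity μ U p := ⟨p, hp⟩
  unfold smoothDensity
  rw [dif_pos h]
  exact h.choose_spec.unique hp

/-- The score function `ρ_U = p' / p`, where `p` is the smooth density of `U`. -/
def score {Ω : Type*} [MeasurableSpace Ω] (μ : Measure Ω) (U : Ω → ℝ) (x : ℝ) : ℝ :=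
  deriv (smoothDensity μ U) x / smoothDensity μ U x

/-- The Fisher information `J(U) = E ρ_U(U)²`. -/
def fisherInfo {Ω : Type*} [MeasurableSpace Ω] (μ : Measure Ω) (U : Ω → ℝ) : ℝ :=
  ∫ ω, score μ U (U ω) ^ 2 ∂μ

/-- `U` has a smooth density, and the expectation that defines its Fisher information is finite. -/
def HasFiniteFisherInfo {Ω : Type*} [MeasurableSpace Ω] (μ : Measure Ω) (U : Ω → ℝ) : Prop :=
  (∃ p, HasSmoothDensity μ U p) ∧ Integrable (fun ω => score μ U (U ω) ^ 2) μ

/-- The normalized combination `√β X + √(1-β) Y`. -/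
def mix {Ω : Type*} (β : ℝ) (X Y : Ω → ℝ) (ω : Ω) : ℝ :=
  Real.sqrt β * X ω + Real.sqrt (1 - β) * Y ω

/-- The squared difference whose expectation is `Δ(X, Y, β)`. -/
def scoreGapSq {Ω : Type*} [MeasurableSpace Ω] (μ : Measure Ω) (X Y : Ω → ℝ) (β : ℝ)
    (ω : Ω) : ℝ :=
  (Real.sqrt β * score μ X (X ω) + Real.sqrt (1 - β) * score μ Y (Y ω)
    - score μ (mix β X Y) (mix β X Y ω)) ^ 2

/-- `Δ(X, Y, β) = E (√β ρ_X(X) + √(1-β) ρ_Y(Y) - ρ̃(√β X + √(1-β) Y))²`, where `ρ̃` is the score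
function of `√β X + √(1-β) Y`. -/
def scoreGap {Ω : Type*} [MeasurableSpace Ω] (μ : Measure Ω) (X Y : Ω → ℝ) (β : ℝ) : ℝ :=
  ∫ ω, scoreGapSq μ X Y β ω ∂μ

/-- The (strong, `α`-) mixing coefficient of two real random variables: the supremum over Borel
sets `A`, `B` of `|P(S ∈ A, T ∈ B) - P(S ∈ A) P(T ∈ B)|`. -/
def alphaMixing {Ω : Type*} [MeasurableSpace Ω] (μ : Measure Ω) (S T : Ω → ℝ) : ℝ :=
  sSup {r : ℝ | ∃ A B : Set ℝ, MeasurableSet A ∧ MeasurableSet B ∧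
    r = |μ.real (S ⁻¹' A ∩ T ⁻¹' B) - μ.real (S ⁻¹' A) * μ.real (T ⁻¹' B)|}

/-- The supremum that defines the mixing coefficient is over a set bounded by `1`. -/
theorem le_alphaMixing {Ω : Type*} [MeasurableSpace Ω] (μ : Measure Ω) [IsProbabilityMeasure μ]
    (S T : Ω → ℝ) {A B : Set ℝ} (hA : MeasurableSet A) (hB : MeasurableSet B) :
    |μ.real (S ⁻¹' A ∩ T ⁻¹' B) - μ.real (S ⁻¹' A) * μ.real (T ⁻¹' B)|
      ≤ alphaMixing μ S T := by
  refine le_csSup ⟨1, ?_⟩ ⟨A, B, hA, hB, rfl⟩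
  rintro r ⟨A, B, -, -, rfl⟩
  have h1 : μ.real (S ⁻¹' A ∩ T ⁻¹' B) ≤ 1 := measureReal_le_one
  have h2 : 0 ≤ μ.real (S ⁻¹' A ∩ T ⁻¹' B) := measureReal_nonneg
  have h3 : μ.real (S ⁻¹' A) * μ.real (T ⁻¹' B) ≤ 1 :=
    mul_le_one₀ measureReal_le_one measureReal_nonneg measureReal_le_one
  have h4 : 0 ≤ μ.real (S ⁻¹' A) * μ.real (T ⁻¹' B) := by positivity
  rw [abs_le]
  constructor <;> linarith

end

/-! Write N_S = -Z_S/τ, N_T = -Z_T/τ, a = √β, b = √(1-β), and let W = aX + bY. The score of a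
Gaussian smoothing V + Z is the conditional expectation of -Z/τ given V + Z
(`integral_mul_eq_gaussScore`). As a² + b² = 1, W is itself such a smoothing, with noise aZ_S + bZ_T
of law N(0, τ), so J(W) = E (aN_S + bN_T) ρ̃(W). Moreover E N_T ρ_X(X) = 0 by independence.
Expanding the square in Δ with these two relations (`integral_sq_sub_eq`) gives a²J(X) + b²J(Y) -
J(W) plus three errors, with coefficients at most 2 in absolute value, of the form E (N_S - ρ_X(X))
r(X, Y) or the same with S and T exchanged, where r is built from one score.

Such an error vanishes if S and T are independent. In general it is at most a constant times αB⁴ +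
B^(η-k) for every B ≥ 1 (`exists_decorrelation_const`). On a box of side 2B, integrating out the
noise leaves, at each (x, y), the covariance of a bounded centred function of S with a bounded
function of T, which α controls (`abs_integral_mul_le_alphaMixing`). The area of the box contributes
B², and the linear growth of the two scores (`abs_gaussScore_le`) one further B each. Off the box
the probability is O(B^(-k)), and the scores have moments of all orders, bounded in terms of τ alone
(`integral_gaussScore_pow_le`), so only an arbitrarily small power of B is lost.

The choice B = α^(-1/(k+4)) balances the two terms and gives the exponent k/(k+4), up to ε
(`le_rpow_of_forall_le`). Moments may be taken about any centres: the first claim is k = 2 about the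
means, the second is k about 0. -/

noncomputable section

/-! ### The Gaussian kernel and smoothness of Gaussian convolutions -/

open Polynomial in
/-- `x ↦ ∫ P(x - v) φ(x - v) dν(v)`, where `φ` is the density of `N(0, τ)`. -/
def gaussTransform (τ : ℝ≥0) (ν : Measure ℝ) (P : ℝ[X]) (x : ℝ) : ℝ :=
  ∫ v, P.eval (x - v) * gaussianPDFReal 0 τ (x - v) ∂ν

theorem continuous_gaussianPDFReal (m : ℝ) (τ : ℝ≥0) : Continuous (gaussianPDFReal m τ) := by
  unfold gaussianPDFReal
  fun_prop

theorem hasDerivAt_gaussianPDFReal (τ : ℝ≥0) (u : ℝ) :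
    HasDerivAt (gaussianPDFReal 0 τ) (-(u / τ) * gaussianPDFReal 0 τ u) u := by
  have h : HasDerivAt (fun u : ℝ => -(u - 0) ^ 2 / (2 * (τ : ℝ))) (-(u / τ)) u := by
    have := (((hasDerivAt_id u).sub_const 0).pow 2).neg.div_const (2 * (τ : ℝ))
    refine this.congr_deriv ?_
    rw [show -((2 : ℕ) * (id u - 0) ^ (2 - 1) * 1) = 2 * (-u) by norm_num,
      mul_div_mul_left _ _ two_ne_zero, neg_div]
  rw [gaussianPDFReal_def]
  refine (h.exp.const_mul (Real.sqrt (2 * Real.pi * τ))⁻¹).congr_deriv ?_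
  ring

theorem abs_pow_mul_gaussianPDFReal_le {τ : ℝ≥0} (hτ : 0 < τ) (n : ℕ) :
    ∃ C, ∀ u : ℝ, |u| ^ n * gaussianPDFReal 0 τ u ≤ C := by
  have hτ' : (0 : ℝ) < τ := hτ
  refine ⟨(1 + (n.factorial : ℝ) * (2 * τ) ^ n) * (Real.sqrt (2 * Real.pi * τ))⁻¹, fun u => ?_⟩
  have h1 : |u| ^ n ≤ 1 + u ^ (2 * n) := by
    rw [pow_mul, ← sq_abs u, ← pow_mul, mul_comm, pow_mul]
    nlinarith [sq_nonneg (|u| ^ n - 1)]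
  have h2 := Real.pow_div_factorial_le_exp (x := u ^ 2 / (2 * τ)) (by positivity) n
  have h3 : u ^ (2 * n) ≤ (n.factorial : ℝ) * (2 * τ) ^ n * Real.exp (u ^ 2 / (2 * τ)) := by
    rw [div_pow, div_div, div_le_iff₀ (by positivity), ← pow_mul] at h2
    linarith
  have h4 : |u| ^ n * Real.exp (-(u - 0) ^ 2 / (2 * τ)) ≤ 1 + (n.factorial : ℝ) * (2 * τ) ^ n := by
    have e : Real.exp (-(u - 0) ^ 2 / (2 * τ)) = (Real.exp (u ^ 2 / (2 * τ)))⁻¹ := by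
      rw [← Real.exp_neg]; congr 1; ring
    rw [e, ← div_eq_mul_inv, div_le_iff₀ (Real.exp_pos _)]
    have : 1 ≤ Real.exp (u ^ 2 / (2 * τ)) := Real.one_le_exp (by positivity)
    nlinarith
  rw [gaussianPDFReal]
  calc _ = |u| ^ n * Real.exp (-(u - 0) ^ 2 / (2 * τ)) * (Real.sqrt (2 * Real.pi * τ))⁻¹ := by ring
    _ ≤ _ := by gcongr

open Polynomial in
theorem abs_polynomial_mul_gaussianPDFReal_le {τ : ℝ≥0} (hτ : 0 < τ) (P : ℝ[X]) :
    ∃ C, ∀ u : ℝ, |P.eval u * gaussianPDFReal 0 τ u| ≤ C := by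
  induction P using Polynomial.induction_on' with
  | add p q hp hq =>
    obtain ⟨C, hC⟩ := hp
    obtain ⟨D, hD⟩ := hq
    refine ⟨C + D, fun u => ?_⟩
    rw [eval_add, add_mul]
    exact (abs_add_le _ _).trans (add_le_add (hC u) (hD u))
  | monomial n a =>
    obtain ⟨C, hC⟩ := abs_pow_mul_gaussianPDFReal_le hτ n
    refine ⟨|a| * C, fun u => ?_⟩
    rw [eval_monomial, mul_assoc, abs_mul, abs_mul, abs_pow,
      abs_of_nonneg (gaussianPDFReal_nonneg 0 τ u)]
    gcongr
    exact hC u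

open Polynomial in
theorem integrable_polynomial_mul_gaussianPDFReal {τ : ℝ≥0} (hτ : 0 < τ) (ν : Measure ℝ)
    [IsFiniteMeasure ν] (P : ℝ[X]) (x : ℝ) :
    Integrable (fun v => P.eval (x - v) * gaussianPDFReal 0 τ (x - v)) ν := by
  obtain ⟨C, hC⟩ := abs_polynomial_mul_gaussianPDFReal_le hτ P
  refine Integrable.of_bound (C := C) ?_ (ae_of_all _ fun v => hC _)
  have := continuous_gaussianPDFReal 0 τ
  exact Continuous.aestronglyMeasurable (by fun_prop)

-- Polynomials times the Gaussian density are closed under differentiation, and each is bounded on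
-- the whole line. A constant therefore dominates the derivative of the integrand, which is enough
-- against a finite measure.
open Polynomial in
theorem hasDerivAt_gaussTransform {τ : ℝ≥0} (hτ : 0 < τ) (ν : Measure ℝ) [IsFiniteMeasure ν]
    (P : ℝ[X]) (x : ℝ) :
    HasDerivAt (gaussTransform τ ν P)
      (gaussTransform τ ν (derivative P - C (τ : ℝ)⁻¹ * X * P) x) x := by
  obtain ⟨K, hK⟩ := abs_polynomial_mul_gaussianPDFReal_le hτ (derivative P - C (τ : ℝ)⁻¹ * X * P)
  refine (hasDerivAt_integral_of_dominated_loc_of_deriv_le (s := Set.univ) (bound := fun _ => K)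
    (F := fun x v => P.eval (x - v) * gaussianPDFReal 0 τ (x - v))
    (F' := fun x v => (derivative P - C (τ : ℝ)⁻¹ * X * P).eval (x - v) *
      gaussianPDFReal 0 τ (x - v)) Filter.univ_mem ?_ ?_ ?_ ?_ ?_ ?_).2
  · exact Filter.Eventually.of_forall fun y =>
      (integrable_polynomial_mul_gaussianPDFReal hτ ν P y).aestronglyMeasurable
  · exact integrable_polynomial_mul_gaussianPDFReal hτ ν P x
  · exact (integrable_polynomial_mul_gaussianPDFReal hτ ν _ x).aestronglyMeasurable
  · exact ae_of_all _ fun v y _ => hK _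
  · exact integrable_const _
  · refine ae_of_all _ fun v y _ => ?_
    have h1 : HasDerivAt (fun y => y - v) 1 y := (hasDerivAt_id y).sub_const v
    have h2 := ((P.hasDerivAt (y - v)).mul (hasDerivAt_gaussianPDFReal τ (y - v))).comp y h1
    refine h2.congr_deriv ?_
    simp only [eval_sub, eval_mul, eval_C, eval_X]
    ring

open Polynomial in
theorem contDiff_gaussTransform {τ : ℝ≥0} (hτ : 0 < τ) (ν : Measure ℝ) [IsFiniteMeasure ν]
    (P : ℝ[X]) : ContDiff ℝ ((⊤ : ℕ∞) : WithTop ℕ∞) (gaussTransform τ ν P) := by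
  refine contDiff_infty.2 fun n => ?_
  -- The derivative is a transform of the same kind with another polynomial, so the induction has to
  -- range over all `P`.
  induction n generalizing P with
  | zero =>
    exact contDiff_zero.2 (continuous_iff_continuousAt.2 fun x =>
      (hasDerivAt_gaussTransform hτ ν P x).continuousAt)
  | succ n ih =>
    have hd : deriv (gaussTransform τ ν P)
        = gaussTransform τ ν (derivative P - C (τ : ℝ)⁻¹ * X * P) :=
      funext fun x => (hasDerivAt_gaussTransform hτ ν P x).deriv
    push_cast
    refine contDiff_succ_iff_deriv.2 ⟨fun x => (hasDerivAt_gaussTransform hτ ν P x).differentiableAt,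
      by simp, ?_⟩
    rw [hd]
    exact ih _

/-! ### Density and score of a Gaussian convolution -/

/-- The density of the convolution of `ν` and `N(0, τ)`. -/
def gaussSmooth (τ : ℝ≥0) (ν : Measure ℝ) (x : ℝ) : ℝ :=
  ∫ v, gaussianPDFReal 0 τ (x - v) ∂ν

/-- The derivative of `gaussSmooth`. -/
def gaussSmoothDeriv (τ : ℝ≥0) (ν : Measure ℝ) (x : ℝ) : ℝ :=
  ∫ v, -((x - v) / τ) * gaussianPDFReal 0 τ (x - v) ∂ν

/-- The score function of the convolution of `ν` and `N(0, τ)`. -/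
def gaussScore (τ : ℝ≥0) (ν : Measure ℝ) (x : ℝ) : ℝ :=
  gaussSmoothDeriv τ ν x / gaussSmooth τ ν x

theorem gaussSmooth_eq (τ : ℝ≥0) (ν : Measure ℝ) : gaussSmooth τ ν = gaussTransform τ ν 1 := by
  funext x
  simp [gaussSmooth, gaussTransform]

theorem integrable_gaussSmooth {τ : ℝ≥0} (hτ : 0 < τ) (ν : Measure ℝ) [IsFiniteMeasure ν] (x : ℝ) :
    Integrable (fun v => gaussianPDFReal 0 τ (x - v)) ν := by
  simpa using integrable_polynomial_mul_gaussianPDFReal hτ ν 1 x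

theorem integrable_gaussSmoothDeriv {τ : ℝ≥0} (hτ : 0 < τ) (ν : Measure ℝ) [IsFiniteMeasure ν]
    (x : ℝ) : Integrable (fun v => -((x - v) / τ) * gaussianPDFReal 0 τ (x - v)) ν := by
  have := integrable_polynomial_mul_gaussianPDFReal hτ ν
    (-(Polynomial.C (τ : ℝ)⁻¹ * Polynomial.X)) x
  convert this using 3
  simp
  ring

theorem deriv_gaussSmooth {τ : ℝ≥0} (hτ : 0 < τ) (ν : Measure ℝ) [IsFiniteMeasure ν] :
    deriv (gaussSmooth τ ν) = gaussSmoothDeriv τ ν := by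
  funext x
  rw [gaussSmooth_eq, (hasDerivAt_gaussTransform hτ ν 1 x).deriv]
  simp only [gaussTransform, gaussSmoothDeriv]
  congr 1
  funext v
  simp
  left
  ring

theorem contDiff_gaussSmooth {τ : ℝ≥0} (hτ : 0 < τ) (ν : Measure ℝ) [IsFiniteMeasure ν] :
    ContDiff ℝ ((⊤ : ℕ∞) : WithTop ℕ∞) (gaussSmooth τ ν) := by
  rw [gaussSmooth_eq]
  exact contDiff_gaussTransform hτ ν 1

theorem gaussSmooth_pos {τ : ℝ≥0} (hτ : 0 < τ) (ν : Measure ℝ) [IsProbabilityMeasure ν] (x : ℝ) :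
    0 < gaussSmooth τ ν x := by
  rw [gaussSmooth, integral_pos_iff_support_of_nonneg (fun v => gaussianPDFReal_nonneg 0 τ _)
    (integrable_gaussSmooth hτ ν x)]
  have : Function.support (fun v => gaussianPDFReal 0 τ (x - v)) = Set.univ :=
    Set.eq_univ_of_forall fun v => (gaussianPDFReal_pos 0 τ (x - v) hτ.ne').ne'
  rw [this]
  simp

theorem continuous_gaussScore {τ : ℝ≥0} (hτ : 0 < τ) (ν : Measure ℝ) [IsProbabilityMeasure ν] :
    Continuous (gaussScore τ ν) := by
  have h := contDiff_gaussSmooth hτ ν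
  have h1 : Continuous (gaussSmoothDeriv τ ν) := by
    rw [← deriv_gaussSmooth hτ ν]
    exact h.continuous_deriv (by simp)
  exact h1.div h.continuous fun x => (gaussSmooth_pos hτ ν x).ne'

theorem gaussScore_mul_gaussSmooth {τ : ℝ≥0} (hτ : 0 < τ) (ν : Measure ℝ) [IsProbabilityMeasure ν]
    (x : ℝ) : gaussScore τ ν x * gaussSmooth τ ν x = gaussSmoothDeriv τ ν x :=
  div_mul_cancel₀ _ (gaussSmooth_pos hτ ν x).ne'

/-! ### Disintegration of the smoothed variable over its source -/

/-- The joint law of `f(V) + Z` and `V`, for a Gaussian variable `Z` independent of `V`. -/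
theorem map_add_gaussian_prodMk {Ω E : Type*} [MeasurableSpace Ω] [MeasurableSpace E]
    {μ : Measure Ω} [IsProbabilityMeasure μ] {V : Ω → E} {Z : Ω → ℝ} {f : E → ℝ} {τ : ℝ≥0}
    (hτ : 0 < τ) (hV : Measurable V) (hZ : Measurable Z) (hf : Measurable f)
    (hlaw : HasLaw Z (gaussianReal 0 τ) μ) (hi : IndepFun V Z μ) :
    μ.map (fun ω => (f (V ω) + Z ω, V ω))
      = ((volume : Measure ℝ).prod (μ.map V)).withDensity
          (fun p => gaussianPDF 0 τ (p.1 - f p.2)) := by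
  have : IsProbabilityMeasure (μ.map V) := Measure.isProbabilityMeasure_map hV.aemeasurable
  have hφ := measurable_gaussianPDF 0 τ
  refine Measure.ext_of_lintegral _ fun g hg => ?_
  have hVZ : μ.map (fun ω => (V ω, Z ω)) = (μ.map V).prod (gaussianReal 0 τ) := by
    rw [(indepFun_iff_map_prod_eq_prod_map_map hV.aemeasurable hZ.aemeasurable).1 hi, hlaw.map_eq]
  have hd : Measurable (fun p : ℝ × E => gaussianPDF 0 τ (p.1 - f p.2)) := by fun_prop
  rw [lintegral_map hg (by fun_prop), lintegral_withDensity_eq_lintegral_mul _ hd hg,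
    lintegral_prod_symm' _ (hd.mul hg)]
  calc ∫⁻ ω, g (f (V ω) + Z ω, V ω) ∂μ
      = ∫⁻ q, g (f q.1 + q.2, q.1) ∂(μ.map (fun ω => (V ω, Z ω))) := by
        rw [lintegral_map (by fun_prop) (by fun_prop)]
    _ = ∫⁻ v, ∫⁻ z, g (f v + z, v) ∂(gaussianReal 0 τ) ∂(μ.map V) := by
        rw [hVZ, lintegral_prod _ (Measurable.aemeasurable (by fun_prop))]
    _ = _ := by
        refine lintegral_congr fun v => ?_
        rw [gaussianReal_of_var_ne_zero _ hτ.ne',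
          lintegral_withDensity_eq_lintegral_mul _ hφ (by fun_prop)]
        -- The substitution x = f(v) + z, by translation invariance of Lebesgue measure.
        refine Eq.trans ?_ (lintegral_add_left_eq_self
          (fun x => gaussianPDF 0 τ (x - f v) * g (x, v)) (f v))
        simp

/-- Fubini's theorem for the joint law of `f(V) + Z` and `V`. -/
theorem integral_add_gaussian {Ω E : Type*} [MeasurableSpace Ω] [MeasurableSpace E]
    {μ : Measure Ω} [IsProbabilityMeasure μ] {V : Ω → E} {Z : Ω → ℝ} {f : E → ℝ} {τ : ℝ≥0}
    (hτ : 0 < τ) (hV : Measurable V) (hZ : Measurable Z) (hf : Measurable f)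
    (hlaw : HasLaw Z (gaussianReal 0 τ) μ) (hi : IndepFun V Z μ) {g : ℝ × E → ℝ}
    (hg : Measurable g) (hint : Integrable (fun ω => g (f (V ω) + Z ω, V ω)) μ) :
    ∫ ω, g (f (V ω) + Z ω, V ω) ∂μ
      = ∫ x, ∫ ω, gaussianPDFReal 0 τ (x - f (V ω)) * g (x, V ω) ∂μ := by
  have : IsProbabilityMeasure (μ.map V) := Measure.isProbabilityMeasure_map hV.aemeasurable
  have hφ := measurable_gaussianPDF 0 τ
  have hφr := measurable_gaussianPDFReal 0 τ
  have hmap := map_add_gaussian_prodMk hτ hV hZ hf hlaw hi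
  have hd : Measurable (fun p : ℝ × E => gaussianPDF 0 τ (p.1 - f p.2)) := by fun_prop
  have hlt : ∀ᵐ p : ℝ × E ∂((volume : Measure ℝ).prod (μ.map V)),
    gaussianPDF 0 τ (p.1 - f p.2) < ∞ := ae_of_all _ fun v => gaussianPDF_lt_top
  have hgi : Integrable g (μ.map (fun ω => (f (V ω) + Z ω, V ω))) := by
    rwa [integrable_map_measure hg.aestronglyMeasurable (by fun_prop)]
  rw [hmap, integrable_withDensity_iff_integrable_smul' hd hlt] at hgi
  calc ∫ ω, g (f (V ω) + Z ω, V ω) ∂μ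
      = ∫ p, g p ∂(μ.map (fun ω => (f (V ω) + Z ω, V ω))) := by
        rw [integral_map (by fun_prop) hg.aestronglyMeasurable]
    _ = ∫ x, ∫ v, (gaussianPDF 0 τ (x - f v)).toReal • g (x, v) ∂(μ.map V) := by
        rw [hmap, integral_withDensity_eq_integral_toReal_smul hd hlt, integral_prod _ hgi]
    _ = _ := by
        refine integral_congr_ae (ae_of_all _ fun x => ?_)
        simp only [toReal_gaussianPDF, smul_eq_mul]
        rw [integral_map (by fun_prop) (Measurable.aestronglyMeasurable (by fun_prop))]

theorem map_add_gaussian {Ω : Type*} [MeasurableSpace Ω]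
    {μ : Measure Ω} [IsProbabilityMeasure μ] {V Z : Ω → ℝ} {τ : ℝ≥0}
    (hτ : 0 < τ) (hV : Measurable V) (hZ : Measurable Z)
    (hlaw : HasLaw Z (gaussianReal 0 τ) μ) (hi : IndepFun V Z μ) :
    μ.map (V + Z) = (volume : Measure ℝ).withDensity
      (fun x => ENNReal.ofReal (gaussSmooth τ (μ.map V) x)) := by
  have : IsProbabilityMeasure (μ.map V) := Measure.isProbabilityMeasure_map hV.aemeasurable
  have h := map_add_gaussian_prodMk hτ hV hZ measurable_id hlaw hi
  have hφ := measurable_gaussianPDF 0 τ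
  have e : μ.map (V + Z) = (μ.map (fun ω => (id (V ω) + Z ω, V ω))).map Prod.fst := by
    rw [Measure.map_map measurable_fst (by fun_prop)]
    rfl
  rw [e, h]
  ext s hs
  rw [Measure.map_apply measurable_fst hs, withDensity_apply _ (measurable_fst hs),
    withDensity_apply _ hs, ← Set.prod_univ, ← Measure.prod_restrict, Measure.restrict_univ,
    lintegral_prod _ (Measurable.aemeasurable (by fun_prop))]
  refine lintegral_congr fun x => ?_
  rw [gaussSmooth, ofReal_integral_eq_lintegral_ofReal (integrable_gaussSmooth hτ _ x)
    (ae_of_all _ fun v => gaussianPDFReal_nonneg _ _ _)]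
  rfl

theorem hasSmoothDensity_add_gaussian {Ω : Type*} [MeasurableSpace Ω]
    {μ : Measure Ω} [IsProbabilityMeasure μ] {V Z : Ω → ℝ} {τ : ℝ≥0}
    (hτ : 0 < τ) (hV : Measurable V) (hZ : Measurable Z)
    (hlaw : HasLaw Z (gaussianReal 0 τ) μ) (hi : IndepFun V Z μ) :
    HasSmoothDensity μ (V + Z) (gaussSmooth τ (μ.map V)) := by
  have : IsProbabilityMeasure (μ.map V) := Measure.isProbabilityMeasure_map hV.aemeasurable
  exact ⟨(hV.add hZ).aemeasurable, contDiff_gaussSmooth hτ _, fun x => (gaussSmooth_pos hτ _ x).le,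
    map_add_gaussian hτ hV hZ hlaw hi⟩

theorem score_add_gaussian {Ω : Type*} [MeasurableSpace Ω]
    {μ : Measure Ω} [IsProbabilityMeasure μ] {V Z : Ω → ℝ} {τ : ℝ≥0}
    (hτ : 0 < τ) (hV : Measurable V) (hZ : Measurable Z)
    (hlaw : HasLaw Z (gaussianReal 0 τ) μ) (hi : IndepFun V Z μ) :
    score μ (V + Z) = gaussScore τ (μ.map V) := by
  have : IsProbabilityMeasure (μ.map V) := Measure.isProbabilityMeasure_map hV.aemeasurable
  funext x
  rw [score, (hasSmoothDensity_add_gaussian hτ hV hZ hlaw hi).smoothDensity_eq,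
    deriv_gaussSmooth hτ]
  rfl

/-! ### Moments of the score, and the score as a projection -/

/-- Jensen's inequality for the measure φ(x - v) dν(v), which when normalised is the law of V given
V + Z = x. The score at x is the mean of -(x - v)/τ under it. -/
theorem abs_gaussScore_pow_mul_le {τ : ℝ≥0} (hτ : 0 < τ) (ν : Measure ℝ) [IsProbabilityMeasure ν]
    (q : ℕ) (x : ℝ) :
    gaussSmooth τ ν x * |gaussScore τ ν x| ^ q
      ≤ ∫ v, gaussianPDFReal 0 τ (x - v) * (|x - v| / τ) ^ q ∂ν := by
  set κ : Measure ℝ := ν.withDensity (fun v => gaussianPDF 0 τ (x - v)) with hκ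
  have hm : Measurable (fun v => gaussianPDF 0 τ (x - v)) := by
    have := measurable_gaussianPDF 0 τ
    fun_prop
  have hlt : ∀ᵐ v ∂ν, gaussianPDF 0 τ (x - v) < ∞ := ae_of_all _ fun v => gaussianPDF_lt_top
  have hp := gaussSmooth_pos hτ ν x
  have hκu : κ Set.univ = ENNReal.ofReal (gaussSmooth τ ν x) := by
    rw [hκ, withDensity_apply _ MeasurableSet.univ, Measure.restrict_univ, gaussSmooth,
      ofReal_integral_eq_lintegral_ofReal (integrable_gaussSmooth hτ ν x)
        (ae_of_all _ fun v => gaussianPDFReal_nonneg _ _ _)]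
    rfl
  have : IsFiniteMeasure κ := ⟨by rw [hκu]; exact ENNReal.ofReal_lt_top⟩
  have : NeZero κ := ⟨fun h => by
    rw [h] at hκu
    simp only [Measure.coe_zero, Pi.zero_apply] at hκu
    exact (ENNReal.ofReal_pos.2 hp).ne hκu⟩
  have hint : ∀ n : ℕ, Integrable (fun v => (|x - v| / τ) ^ n) κ := fun n => by
    rw [hκ, integrable_withDensity_iff_integrable_smul' hm hlt]
    have h := (integrable_polynomial_mul_gaussianPDFReal hτ ν
      ((Polynomial.C (τ : ℝ)⁻¹ * Polynomial.X) ^ n) x).norm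
    refine h.congr (ae_of_all _ fun v => ?_)
    simp only [toReal_gaussianPDF, smul_eq_mul, Polynomial.eval_pow, Polynomial.eval_mul,
      Polynomial.eval_C, Polynomial.eval_X, Real.norm_eq_abs, abs_mul, abs_pow,
      abs_of_nonneg (gaussianPDFReal_nonneg 0 τ (x - v))]
    rw [abs_of_nonneg (inv_nonneg.2 τ.coe_nonneg)]
    ring
  -- The average divides by the mass of `κ`, which is the density at x.
  have hJ := (convexOn_pow q).map_average_le (μ := κ) (f := fun v => |x - v| / τ)
    (continuous_pow q).continuousOn isClosed_Ici
    (ae_of_all _ fun v => Set.mem_Ici.2 (by positivity)) (by simpa using hint 1) (hint q)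
  have hreal : κ.real Set.univ = gaussSmooth τ ν x := by
    rw [measureReal_def, hκu, ENNReal.toReal_ofReal hp.le]
  have hI : ∀ f : ℝ → ℝ, ∫ v, f v ∂κ = ∫ v, gaussianPDFReal 0 τ (x - v) * f v ∂ν := fun f => by
    rw [hκ, integral_withDensity_eq_integral_toReal_smul hm hlt]
    simp [toReal_gaussianPDF]
  rw [average_eq, average_eq, hreal, hI, hI, smul_eq_mul, smul_eq_mul] at hJ
  have h1 : |gaussScore τ ν x|
      ≤ (gaussSmooth τ ν x)⁻¹ * ∫ v, gaussianPDFReal 0 τ (x - v) * (|x - v| / τ) ∂ν := by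
    rw [gaussScore, abs_div, abs_of_pos hp, div_eq_inv_mul]
    gcongr
    refine (abs_integral_le_integral_abs).trans (le_of_eq (integral_congr_ae (ae_of_all _ fun v => ?_)))
    simp only [abs_mul, abs_neg, abs_div, abs_of_nonneg (gaussianPDFReal_nonneg 0 τ (x - v)),
      abs_of_nonneg τ.coe_nonneg]
    ring
  calc gaussSmooth τ ν x * |gaussScore τ ν x| ^ q
      ≤ gaussSmooth τ ν x * ((gaussSmooth τ ν x)⁻¹ *
          ∫ v, gaussianPDFReal 0 τ (x - v) * (|x - v| / τ) ∂ν) ^ q := by gcongr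
    _ ≤ gaussSmooth τ ν x * ((gaussSmooth τ ν x)⁻¹ *
          ∫ v, gaussianPDFReal 0 τ (x - v) * (|x - v| / τ) ^ q ∂ν) := by gcongr
    _ = _ := by rw [← mul_assoc, mul_inv_cancel₀ hp.ne', one_mul]

section law

variable {Ω : Type*} [MeasurableSpace Ω] {μ : Measure Ω} [IsProbabilityMeasure μ] {V Z : Ω → ℝ}
  {τ : ℝ≥0}

/-- The pointwise Jensen bound is integrated over x and the disintegration undone, which turns x - v
back into Z. The bound is independent of the law of V. Working with `∫⁻` makes integrability a
consequence. -/
theorem lintegral_gaussScore_pow_le (hτ : 0 < τ) (hV : Measurable V) (hZ : Measurable Z)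
    (hlaw : HasLaw Z (gaussianReal 0 τ) μ) (hi : IndepFun V Z μ) (q : ℕ) :
    ∫⁻ ω, ENNReal.ofReal (|gaussScore τ (μ.map V) ((V + Z) ω)| ^ q) ∂μ
      ≤ ∫⁻ z, ENNReal.ofReal ((|z| / τ) ^ q) ∂(gaussianReal 0 τ) := by
  have : IsProbabilityMeasure (μ.map V) := Measure.isProbabilityMeasure_map hV.aemeasurable
  have hs := (continuous_gaussScore hτ (μ.map V)).measurable
  have hp := (contDiff_gaussSmooth hτ (μ.map V)).continuous.measurable
  have hφ := measurable_gaussianPDF 0 τ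
  have hφr := measurable_gaussianPDFReal 0 τ
  have hint : ∀ x, Integrable (fun v => gaussianPDFReal 0 τ (x - v) * (|x - v| / τ) ^ q)
      (μ.map V) := fun x => by
    refine (integrable_polynomial_mul_gaussianPDFReal hτ (μ.map V)
      ((Polynomial.C (τ : ℝ)⁻¹ * Polynomial.X) ^ q) x).norm.congr (ae_of_all _ fun v => ?_)
    simp only [Polynomial.eval_pow, Polynomial.eval_mul,
      Polynomial.eval_C, Polynomial.eval_X, Real.norm_eq_abs, abs_mul, abs_pow,
      abs_of_nonneg (gaussianPDFReal_nonneg 0 τ (x - v))]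
    rw [abs_of_nonneg (inv_nonneg.2 τ.coe_nonneg)]
    ring
  calc ∫⁻ ω, ENNReal.ofReal (|gaussScore τ (μ.map V) ((V + Z) ω)| ^ q) ∂μ
      = ∫⁻ x, ENNReal.ofReal (|gaussScore τ (μ.map V) x| ^ q) ∂(μ.map (V + Z)) := by
        rw [lintegral_map (by fun_prop) (by fun_prop)]
    _ = ∫⁻ x, ENNReal.ofReal (gaussSmooth τ (μ.map V) x * |gaussScore τ (μ.map V) x| ^ q) := by
        rw [map_add_gaussian hτ hV hZ hlaw hi,
          lintegral_withDensity_eq_lintegral_mul _ (by fun_prop) (by fun_prop)]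
        refine lintegral_congr fun x => ?_
        rw [Pi.mul_apply, ENNReal.ofReal_mul (gaussSmooth_pos hτ _ x).le]
    _ ≤ ∫⁻ x, ENNReal.ofReal (∫ v, gaussianPDFReal 0 τ (x - v) * (|x - v| / τ) ^ q ∂(μ.map V)) :=
        lintegral_mono fun x => ENNReal.ofReal_le_ofReal (abs_gaussScore_pow_mul_le hτ _ q x)
    _ = ∫⁻ x, ∫⁻ v, gaussianPDF 0 τ (x - v) * ENNReal.ofReal ((|x - v| / τ) ^ q) ∂(μ.map V) := by
        refine lintegral_congr fun x => ?_
        rw [ofReal_integral_eq_lintegral_ofReal (hint x)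
          (ae_of_all _ fun v => mul_nonneg (gaussianPDFReal_nonneg _ _ _) (by positivity))]
        refine lintegral_congr fun v => ?_
        rw [ENNReal.ofReal_mul (gaussianPDFReal_nonneg _ _ _)]
        rfl
    _ = ∫⁻ p, ENNReal.ofReal ((|p.1 - p.2| / τ) ^ q) ∂(μ.map (fun ω => (id (V ω) + Z ω, V ω))) := by
        rw [map_add_gaussian_prodMk hτ hV hZ measurable_id hlaw hi,
          lintegral_withDensity_eq_lintegral_mul _ (by fun_prop) (by fun_prop),
          lintegral_prod _ (Measurable.aemeasurable (by fun_prop))]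
        rfl
    _ = ∫⁻ ω, ENNReal.ofReal ((|Z ω| / τ) ^ q) ∂μ := by
        rw [lintegral_map (by fun_prop) (by fun_prop)]
        simp
    _ = _ := by
        rw [← hlaw.map_eq, lintegral_map (by fun_prop) hZ]

theorem integrable_abs_pow_gaussianReal (τ : ℝ≥0) (q : ℕ) :
    Integrable (fun z => |z| ^ q) (gaussianReal 0 τ) := by
  have h := (memLp_id_gaussianReal (μ := 0) (v := τ) (q : ℝ≥0)).integrable_norm_pow'
  simpa using h

/-- The `q`-th absolute moment of `Z / τ`, for `Z` of law `N(0, τ)`. -/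
def gaussMoment (τ : ℝ≥0) (q : ℕ) : ℝ := ∫ z, (|z| / τ) ^ q ∂(gaussianReal 0 τ)

theorem gaussMoment_nonneg (τ : ℝ≥0) (q : ℕ) : 0 ≤ gaussMoment τ q :=
  integral_nonneg fun z => by positivity

theorem integrable_gaussMoment (τ : ℝ≥0) (q : ℕ) :
    Integrable (fun z : ℝ => (|z| / τ) ^ q) (gaussianReal 0 τ) := by
  simp_rw [div_pow]
  exact (integrable_abs_pow_gaussianReal τ q).div_const _

theorem lintegral_gaussMoment (τ : ℝ≥0) (q : ℕ) :
    ∫⁻ z, ENNReal.ofReal ((|z| / τ) ^ q) ∂(gaussianReal 0 τ) = ENNReal.ofReal (gaussMoment τ q) :=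
  (ofReal_integral_eq_lintegral_ofReal (integrable_gaussMoment τ q)
    (ae_of_all _ fun z => by positivity)).symm

theorem integrable_gaussScore_pow (hτ : 0 < τ) (hV : Measurable V) (hZ : Measurable Z)
    (hlaw : HasLaw Z (gaussianReal 0 τ) μ) (hi : IndepFun V Z μ) (q : ℕ) :
    Integrable (fun ω => |gaussScore τ (μ.map V) ((V + Z) ω)| ^ q) μ := by
  have : IsProbabilityMeasure (μ.map V) := Measure.isProbabilityMeasure_map hV.aemeasurable
  have hs := (continuous_gaussScore hτ (μ.map V)).measurable
  refine ⟨Measurable.aestronglyMeasurable (by fun_prop), ?_⟩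
  rw [hasFiniteIntegral_iff_ofReal (ae_of_all _ fun ω => by positivity)]
  refine (lintegral_gaussScore_pow_le hτ hV hZ hlaw hi q).trans_lt ?_
  rw [lintegral_gaussMoment]
  exact ENNReal.ofReal_lt_top

theorem integral_gaussScore_pow_le (hτ : 0 < τ) (hV : Measurable V) (hZ : Measurable Z)
    (hlaw : HasLaw Z (gaussianReal 0 τ) μ) (hi : IndepFun V Z μ) (q : ℕ) :
    ∫ ω, |gaussScore τ (μ.map V) ((V + Z) ω)| ^ q ∂μ ≤ gaussMoment τ q := by
  rw [← ENNReal.ofReal_le_ofReal_iff (gaussMoment_nonneg τ q),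
    ofReal_integral_eq_lintegral_ofReal (integrable_gaussScore_pow hτ hV hZ hlaw hi q)
      (ae_of_all _ fun ω => by positivity), ← lintegral_gaussMoment]
  exact lintegral_gaussScore_pow_le hτ hV hZ hlaw hi q

/-- The score of `V + Z` is the projection of `-Z / τ`. -/
theorem integral_mul_eq_gaussScore (hτ : 0 < τ) (hV : Measurable V) (hZ : Measurable Z)
    (hlaw : HasLaw Z (gaussianReal 0 τ) μ) (hi : IndepFun V Z μ) {h : ℝ → ℝ} (hh : Measurable h)
    (hint : Integrable (fun ω => -(Z ω / τ) * h ((V + Z) ω)) μ) :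
    ∫ ω, -(Z ω / τ) * h ((V + Z) ω) ∂μ
      = ∫ ω, gaussScore τ (μ.map V) ((V + Z) ω) * h ((V + Z) ω) ∂μ := by
  have : IsProbabilityMeasure (μ.map V) := Measure.isProbabilityMeasure_map hV.aemeasurable
  have hs := (continuous_gaussScore hτ (μ.map V)).measurable
  have hp := (contDiff_gaussSmooth hτ (μ.map V)).continuous.measurable
  have hφ := measurable_gaussianPDFReal 0 τ
  have hg := integral_add_gaussian hτ hV hZ measurable_id hlaw hi
    (g := fun p : ℝ × ℝ => -((p.1 - p.2) / τ) * h p.1) (by fun_prop)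
    (hint.congr (ae_of_all _ fun ω => by simp))
  simp only [id, add_sub_cancel_left] at hg
  calc ∫ ω, -(Z ω / τ) * h ((V + Z) ω) ∂μ
      = ∫ x, ∫ ω, gaussianPDFReal 0 τ (x - V ω) * (-((x - V ω) / τ) * h x) ∂μ := hg
    _ = ∫ x, gaussSmooth τ (μ.map V) x * (gaussScore τ (μ.map V) x * h x) := by
        refine integral_congr_ae (ae_of_all _ fun x => ?_)
        simp only
        rw [← mul_assoc, mul_comm (gaussSmooth _ _ _), gaussScore_mul_gaussSmooth hτ,
          gaussSmoothDeriv, ← integral_mul_const,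
          integral_map (by fun_prop) (Measurable.aestronglyMeasurable (by fun_prop))]
        refine integral_congr_ae (ae_of_all _ fun v => ?_)
        simp only
        ring
    _ = ∫ x, gaussScore τ (μ.map V) x * h x ∂(μ.map (V + Z)) := by
        rw [map_add_gaussian hτ hV hZ hlaw hi, integral_withDensity_eq_integral_toReal_smul
          (by fun_prop) (ae_of_all _ fun v => ENNReal.ofReal_lt_top)]
        refine integral_congr_ae (ae_of_all _ fun x => ?_)
        simp [ENNReal.toReal_ofReal (gaussSmooth_pos hτ (μ.map V) x).le]
    _ = _ := by
        rw [integral_map (by fun_prop) (Measurable.aestronglyMeasurable (by fun_prop))]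

end law

/-! ### Linear growth of the score -/

/-- For |u| ≤ 2w the first term suffices. Beyond that the exponential is split into two equal
factors: one is below the exponential at w, the other absorbs |u|. -/
theorem abs_mul_gaussianPDFReal_le {τ : ℝ≥0} (hτ : 0 < τ) {w : ℝ} (hw : 0 ≤ w) (u : ℝ) :
    |u| * gaussianPDFReal 0 τ u
      ≤ 2 * w * gaussianPDFReal 0 τ u + (1 + τ) * gaussianPDFReal 0 τ w := by
  have hτ' : (0 : ℝ) < τ := hτ
  have hu := gaussianPDFReal_nonneg 0 τ u
  have hw' := gaussianPDFReal_nonneg 0 τ w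
  rcases le_or_gt |u| (2 * w) with h | h
  · have : 0 ≤ (1 + (τ : ℝ)) * gaussianPDFReal 0 τ w := by positivity
    nlinarith
  have key : |u| * Real.exp (-(u - 0) ^ 2 / (2 * τ))
      ≤ (1 + τ) * Real.exp (-(w - 0) ^ 2 / (2 * τ)) := by
    have e1 : Real.exp (-(u - 0) ^ 2 / (2 * τ))
        = Real.exp (-(u ^ 2 / (4 * τ))) * Real.exp (-(u ^ 2 / (4 * τ))) := by
      rw [← Real.exp_add]
      congr 1
      field_simp
      ring
    have h1 : Real.exp (-(u ^ 2 / (4 * τ))) ≤ Real.exp (-(w - 0) ^ 2 / (2 * τ)) := by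
      refine Real.exp_le_exp.2 ?_
      rw [neg_div, neg_le_neg_iff, div_le_div_iff₀ (by positivity) (by positivity)]
      have : (2 * w) ^ 2 ≤ u ^ 2 := by
        rw [← sq_abs u]
        gcongr
      nlinarith
    have h2 : |u| * Real.exp (-(u ^ 2 / (4 * τ))) ≤ 1 + τ := by
      rw [Real.exp_neg, ← div_eq_mul_inv, div_le_iff₀ (Real.exp_pos _)]
      have h3 := Real.add_one_le_exp (u ^ 2 / (4 * (τ : ℝ)))
      have h4 : |u| ≤ τ + u ^ 2 / (4 * τ) := by
        have : τ + u ^ 2 / (4 * τ) - |u| = (2 * τ - |u|) ^ 2 / (4 * τ) := by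
          rw [← sq_abs u]
          field_simp
          ring
        have : 0 ≤ (2 * τ - |u|) ^ 2 / (4 * (τ : ℝ)) := by positivity
        linarith
      have h5 : 0 ≤ u ^ 2 / (4 * (τ : ℝ)) := by positivity
      nlinarith
    rw [e1, ← mul_assoc]
    exact mul_le_mul h2 h1 (Real.exp_pos _).le (by positivity)
  have h0 : 0 ≤ 2 * w * gaussianPDFReal 0 τ u := by positivity
  refine le_trans ?_ (le_add_of_nonneg_left h0)
  rw [gaussianPDFReal, gaussianPDFReal]
  calc _ = (Real.sqrt (2 * Real.pi * τ))⁻¹ * (|u| * Real.exp (-(u - 0) ^ 2 / (2 * τ))) := by ring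
    _ ≤ (Real.sqrt (2 * Real.pi * τ))⁻¹ * ((1 + τ) * Real.exp (-(w - 0) ^ 2 / (2 * τ))) := by
        gcongr
    _ = _ := by ring

theorem gaussianPDFReal_le_of_abs_le {τ : ℝ≥0} {u w : ℝ} (h : |u| ≤ w) :
    gaussianPDFReal 0 τ w ≤ gaussianPDFReal 0 τ u := by
  rw [gaussianPDFReal, gaussianPDFReal]
  have : u ^ 2 ≤ w ^ 2 := by
    rw [← sq_abs u]
    gcongr
  simp only [sub_zero]
  refine mul_le_mul_of_nonneg_left (Real.exp_le_exp.2 ?_) (by positivity)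
  exact div_le_div_of_nonneg_right (neg_le_neg this) (by positivity)

/-- The score of a Gaussian smoothing grows at most linearly. -/
theorem abs_gaussScore_le {τ : ℝ≥0} (hτ : 0 < τ) (ν : Measure ℝ) [IsProbabilityMeasure ν]
    {R c : ℝ} (hR : 0 ≤ R) (hν : 1 / 2 ≤ ν.real {v | |v - c| ≤ R}) (x : ℝ) :
    |gaussScore τ ν x| ≤ (4 + 2 * R + 2 * τ) / τ * (1 + |x - c|) := by
  have hτ' : (0 : ℝ) < τ := hτ
  have hp := gaussSmooth_pos hτ ν x
  -- Every v within R of c is within w of x, and these v carry half the mass, so the density at x is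
  -- at least φ(w)/2. Using the same w in the upper bound for the derivative lets φ(w) be absorbed
  -- into the density.
  set w := |x - c| + R with hw
  have hw0 : 0 ≤ w := by positivity
  have hφw := gaussianPDFReal_nonneg 0 τ w
  have hms : MeasurableSet {v : ℝ | |v - c| ≤ R} :=
    measurableSet_le (by fun_prop) measurable_const
  have hlow : gaussianPDFReal 0 τ w ≤ 2 * gaussSmooth τ ν x := by
    have h1 : gaussianPDFReal 0 τ w * ν.real {v | |v - c| ≤ R} ≤ gaussSmooth τ ν x := by
      calc _ = ∫ v in {v | |v - c| ≤ R}, gaussianPDFReal 0 τ w ∂ν := by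
            rw [setIntegral_const, smul_eq_mul, mul_comm]
        _ ≤ ∫ v in {v | |v - c| ≤ R}, gaussianPDFReal 0 τ (x - v) ∂ν := by
            refine setIntegral_mono_on (integrable_const _).integrableOn
              (integrable_gaussSmooth hτ ν x).integrableOn hms fun v hv => ?_
            refine gaussianPDFReal_le_of_abs_le ?_
            have h2 : |v - c| ≤ R := hv
            calc |x - v| = |(x - c) - (v - c)| := by ring_nf
              _ ≤ |x - c| + |v - c| := abs_sub _ _
              _ ≤ w := by rw [hw]; gcongr
        _ ≤ _ := setIntegral_le_integral (integrable_gaussSmooth hτ ν x)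
            (ae_of_all _ fun v => gaussianPDFReal_nonneg _ _ _)
    nlinarith
  have hup : |gaussSmoothDeriv τ ν x| * τ
      ≤ 2 * w * gaussSmooth τ ν x + (1 + τ) * gaussianPDFReal 0 τ w := by
    have h1 : |gaussSmoothDeriv τ ν x| * τ ≤ ∫ v, |x - v| * gaussianPDFReal 0 τ (x - v) ∂ν := by
      rw [← le_div_iff₀ hτ', ← integral_div]
      refine (abs_integral_le_integral_abs).trans
        (le_of_eq (integral_congr_ae (ae_of_all _ fun v => ?_)))
      simp only [abs_mul, abs_neg, abs_div, abs_of_nonneg (gaussianPDFReal_nonneg 0 τ (x - v)),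
        abs_of_nonneg τ.coe_nonneg]
      ring
    have hi1 : Integrable (fun v => |x - v| * gaussianPDFReal 0 τ (x - v)) ν := by
      refine (integrable_polynomial_mul_gaussianPDFReal hτ ν Polynomial.X x).norm.congr
        (ae_of_all _ fun v => ?_)
      simp [abs_of_nonneg (gaussianPDFReal_nonneg 0 τ (x - v))]
    have hi2 := (integrable_gaussSmooth hτ ν x).const_mul (2 * w)
    refine h1.trans ((integral_mono hi1 (hi2.add (integrable_const
      ((1 + τ) * gaussianPDFReal 0 τ w))) fun v => abs_mul_gaussianPDFReal_le hτ hw0 _).trans ?_)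
    simp only [Pi.add_apply]
    rw [integral_add hi2 (integrable_const _), integral_const_mul]
    simp [gaussSmooth]
  rw [gaussScore, abs_div, abs_of_pos hp, div_le_iff₀ hp, div_mul_eq_mul_div, div_mul_eq_mul_div,
    le_div_iff₀ hτ']
  refine hup.trans ?_
  have h3 : (1 + (τ : ℝ)) * gaussianPDFReal 0 τ w ≤ (1 + τ) * (2 * gaussSmooth τ ν x) := by gcongr
  have h4 : 2 * w + 2 * (1 + (τ : ℝ)) ≤ (4 + 2 * R + 2 * τ) * (1 + |x - c|) := by
    have : 0 ≤ |x - c| := abs_nonneg _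
    have : 0 ≤ R * |x - c| := by positivity
    have : 0 ≤ τ * |x - c| := by positivity
    rw [hw]
    nlinarith
  nlinarith

/-! ### The mixing coefficient and the covariance inequality -/

theorem alphaMixing_nonneg {Ω : Type*} [MeasurableSpace Ω] (μ : Measure Ω)
    [IsProbabilityMeasure μ] (S T : Ω → ℝ) : 0 ≤ alphaMixing μ S T :=
  (abs_nonneg _).trans (le_alphaMixing μ S T MeasurableSet.empty MeasurableSet.empty)

theorem alphaMixing_le_one {Ω : Type*} [MeasurableSpace Ω] (μ : Measure Ω)
    [IsProbabilityMeasure μ] (S T : Ω → ℝ) : alphaMixing μ S T ≤ 1 := by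
  refine csSup_le ⟨_, ∅, ∅, MeasurableSet.empty, MeasurableSet.empty, rfl⟩ ?_
  rintro r ⟨A, B, -, -, rfl⟩
  have h1 : μ.real (S ⁻¹' A ∩ T ⁻¹' B) ≤ 1 := measureReal_le_one
  have h2 : 0 ≤ μ.real (S ⁻¹' A ∩ T ⁻¹' B) := measureReal_nonneg
  have h3 : μ.real (S ⁻¹' A) * μ.real (T ⁻¹' B) ≤ 1 :=
    mul_le_one₀ measureReal_le_one measureReal_nonneg measureReal_le_one
  have h4 : 0 ≤ μ.real (S ⁻¹' A) * μ.real (T ⁻¹' B) := by positivity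
  rw [abs_le]
  constructor <;> linarith

theorem alphaMixing_comm {Ω : Type*} [MeasurableSpace Ω] (μ : Measure Ω) (S T : Ω → ℝ) :
    alphaMixing μ S T = alphaMixing μ T S := by
  unfold alphaMixing
  congr 1
  ext r
  constructor <;>
  · rintro ⟨A, B, hA, hB, rfl⟩
    exact ⟨B, A, hB, hA, by rw [Set.inter_comm, mul_comm]⟩

section covariance

variable {Ω : Type*} [MeasurableSpace Ω] {μ : Measure Ω} [IsProbabilityMeasure μ]

/-- Layer-cake formula: F(S) is the integral over t in (0, 1] of the indicator of {t ≤ F(S)}, an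
event of the form S ∈ A. Fubini then averages the set-level bounds. -/
theorem abs_integral_comp_mul_le_of_unit {S D : Ω → ℝ} (hS : Measurable S) (hD : Integrable D μ)
    {a : ℝ} (ha : ∀ A, MeasurableSet A → |∫ ω in S ⁻¹' A, D ω ∂μ| ≤ a)
    {F : ℝ → ℝ} (hF : Measurable F) (h0 : ∀ s, 0 ≤ F s) (h1 : ∀ s, F s ≤ 1) :
    |∫ ω, F (S ω) * D ω ∂μ| ≤ a := by
  have key : ∀ ω, F (S ω) * D ω
      = ∫ t in Set.Ioc (0 : ℝ) 1, (Set.Iic (F (S ω))).indicator (fun _ => D ω) t := fun ω => by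
    rw [setIntegral_indicator measurableSet_Iic, setIntegral_const, smul_eq_mul]
    congr 1
    rw [Set.Ioc_inter_Iic, min_eq_right (h1 _)]
    simp [h0]
  have hset : MeasurableSet {p : Ω × ℝ | p.2 ≤ F (S p.1)} :=
    measurableSet_le measurable_snd (by fun_prop)
  have hint : Integrable (Function.uncurry fun ω t => (Set.Iic (F (S ω))).indicator (fun _ => D ω) t)
      (μ.prod (volume.restrict (Set.Ioc (0 : ℝ) 1))) := by
    refine ((hD.comp_fst (volume.restrict (Set.Ioc (0 : ℝ) 1))).indicator hset).congr
      (ae_of_all _ fun p => ?_)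
    simp [Set.indicator, Function.uncurry]
  simp_rw [key]
  rw [integral_integral_swap hint]
  have hb : ∀ t : ℝ, ‖∫ ω, (Set.Iic (F (S ω))).indicator (fun _ => D ω) t ∂μ‖ ≤ a := fun t => by
    have hA : MeasurableSet {s | t ≤ F s} := measurableSet_le measurable_const hF
    have h := ha _ hA
    rw [← integral_indicator (hS hA)] at h
    refine le_of_eq_of_le ?_ h
    rw [Real.norm_eq_abs]
    congr 1
  have := norm_setIntegral_le_of_norm_le_const (μ := (volume : Measure ℝ)) (s := Set.Ioc (0 : ℝ) 1)
    (C := a) (by simp) (fun t _ => hb t)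
  simpa using this

/-- The function (F + L)/(2L) takes values in [0, 1], and the added constant is harmless because D
has mean zero. -/
theorem abs_integral_comp_mul_le {S D : Ω → ℝ} (hS : Measurable S) (hD : Integrable D μ)
    (hD0 : ∫ ω, D ω ∂μ = 0)
    {a : ℝ} (ha : ∀ A, MeasurableSet A → |∫ ω in S ⁻¹' A, D ω ∂μ| ≤ a)
    {F : ℝ → ℝ} (hF : Measurable F) {L : ℝ} (hL : 0 < L) (hFL : ∀ s, |F s| ≤ L) :
    |∫ ω, F (S ω) * D ω ∂μ| ≤ 2 * L * a := by
  have h := abs_integral_comp_mul_le_of_unit hS hD ha (F := fun s => (F s + L) / (2 * L))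
    (by fun_prop) (fun s => div_nonneg (by linarith [(abs_le.1 (hFL s)).1]) (by positivity))
    (fun s => by
      rw [div_le_one (by positivity)]
      linarith [(abs_le.1 (hFL s)).2])
  have hFD : Integrable (fun ω => F (S ω) * D ω) μ :=
    hD.bdd_mul (c := L) (Measurable.aestronglyMeasurable (by fun_prop))
      (ae_of_all _ fun ω => hFL _)
  have e : ∫ ω, (F (S ω) + L) / (2 * L) * D ω ∂μ = (∫ ω, F (S ω) * D ω ∂μ) / (2 * L) := by
    have : ∀ ω, (F (S ω) + L) / (2 * L) * D ω = (F (S ω) * D ω + L * D ω) / (2 * L) :=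
      fun ω => by ring
    simp_rw [this]
    rw [integral_div, integral_add hFD (hD.const_mul L), integral_const_mul, hD0]
    simp
  rw [e, abs_div, abs_of_pos (by positivity : 0 < 2 * L), div_le_iff₀ (by positivity)] at h
  linarith

/-- The covariance inequality for bounded functions of `α`-mixing variables, one of them centred. -/
theorem abs_integral_mul_le_alphaMixing {S T : Ω → ℝ} (hS : Measurable S) (hT : Measurable T)
    {F G : ℝ → ℝ} (hF : Measurable F) (hG : Measurable G) {L L' : ℝ} (hL : 0 < L) (hL' : 0 < L')
    (hFL : ∀ s, |F s| ≤ L) (hGL : ∀ s, |G s| ≤ L') (hF0 : ∫ ω, F (S ω) ∂μ = 0) :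
    |∫ ω, F (S ω) * G (T ω) ∂μ| ≤ 4 * L * L' * alphaMixing μ S T := by
  have hFi : Integrable (fun ω => F (S ω)) μ :=
    Integrable.of_bound (C := L) (Measurable.aestronglyMeasurable (by fun_prop))
      (ae_of_all _ fun ω => hFL _)
  -- First pass, from events of S to functions of S, with D the centred indicator of T ∈ B. Since
  -- F(S) has mean zero, the centring drops out of the conclusion.
  have hB : ∀ B, MeasurableSet B →
      |∫ ω in T ⁻¹' B, F (S ω) ∂μ| ≤ 2 * L * alphaMixing μ S T := fun B hB => by
    set D : Ω → ℝ := fun ω => (T ⁻¹' B).indicator (fun _ => (1 : ℝ)) ω - μ.real (T ⁻¹' B) with hDdef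
    have hi : Integrable ((T ⁻¹' B).indicator (fun _ => (1 : ℝ))) μ :=
      (integrable_const 1).indicator (hT hB)
    have hD : Integrable D μ := hi.sub (integrable_const _)
    have hDA : ∀ A, MeasurableSet A → |∫ ω in S ⁻¹' A, D ω ∂μ| ≤ alphaMixing μ S T :=
      fun A hA => by
        have : ∫ ω in S ⁻¹' A, D ω ∂μ
            = μ.real (S ⁻¹' A ∩ T ⁻¹' B) - μ.real (S ⁻¹' A) * μ.real (T ⁻¹' B) := by
          rw [hDdef, integral_sub hi.integrableOn (integrable_const _).integrableOn,
            setIntegral_indicator (hT hB), setIntegral_const, setIntegral_const]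
          simp
        rw [this]
        exact le_alphaMixing μ S T hA hB
    have hD0 : ∫ ω, D ω ∂μ = 0 := by
      rw [hDdef, integral_sub hi (integrable_const _), integral_indicator (hT hB)]
      simp
    have h := abs_integral_comp_mul_le hS hD hD0 hDA hF hL hFL
    refine le_of_eq_of_le ?_ h
    congr 1
    have e : ∀ ω, F (S ω) * D ω = (T ⁻¹' B).indicator (fun ω => F (S ω)) ω
        - F (S ω) * μ.real (T ⁻¹' B) := fun ω => by
      simp only [hDdef, Set.indicator]
      split_ifs <;> ring
    simp_rw [e]
    rw [integral_sub (hFi.indicator (hT hB)) (hFi.mul_const _), integral_mul_const, hF0,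
      integral_indicator (hT hB)]
    simp
  -- Second pass, from events of T to functions of T, with D = F(S). Each pass costs a factor 2.
  have h := abs_integral_comp_mul_le hT hFi hF0 hB hG hL' hGL
  simp_rw [mul_comm (F _)]
  linarith

end covariance

/-! ### Independence relations between the signals and the noise -/

/-- The variables `S, T`, and independent noise `ZS, ZT` of law `N(0, τ)`. -/
structure IsGaussianNoise {Ω : Type*} [MeasurableSpace Ω] (μ : Measure Ω) (τ : ℝ≥0)
    (S T ZS ZT : Ω → ℝ) : Prop where
  measS : Measurable S
  measT : Measurable T
  measZS : Measurable ZS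
  measZT : Measurable ZT
  lawS : HasLaw ZS (gaussianReal 0 τ) μ
  lawT : HasLaw ZT (gaussianReal 0 τ) μ
  indep : IndepFun (fun ω => (S ω, T ω)) (fun ω => (ZS ω, ZT ω)) μ
  indepZ : IndepFun ZS ZT μ

theorem ProbabilityTheory.IndepFun.prodMk_assoc {Ω E F G : Type*} [MeasurableSpace Ω]
    [MeasurableSpace E] [MeasurableSpace F] [MeasurableSpace G] {μ : Measure Ω}
    [IsProbabilityMeasure μ] {U : Ω → E} {A : Ω → F} {B : Ω → G} (hU : Measurable U)
    (hA : Measurable A) (hB : Measurable B) (h : IndepFun U (fun ω => (A ω, B ω)) μ)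
    (hAB : IndepFun A B μ) : IndepFun (fun ω => (U ω, A ω)) B μ := by
  have : IsProbabilityMeasure (μ.map U) := Measure.isProbabilityMeasure_map hU.aemeasurable
  have : IsProbabilityMeasure (μ.map A) := Measure.isProbabilityMeasure_map hA.aemeasurable
  have : IsProbabilityMeasure (μ.map B) := Measure.isProbabilityMeasure_map hB.aemeasurable
  have hUA : IndepFun U A μ := h.comp measurable_id measurable_fst
  rw [indepFun_iff_map_prod_eq_prod_map_map (by fun_prop) (by fun_prop)] at h hAB hUA ⊢
  rw [hAB] at h
  apply MeasurableEquiv.prodAssoc.map_measurableEquiv_injective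
  rw [hUA, Measure.prodAssoc_prod, ← h, Measure.map_map (by fun_prop) (by fun_prop)]
  rfl

namespace IsGaussianNoise

variable {Ω : Type*} [MeasurableSpace Ω] {μ : Measure Ω} {τ : ℝ≥0}
  {S T ZS ZT : Ω → ℝ}

theorem swap (h : IsGaussianNoise μ τ S T ZS ZT) : IsGaussianNoise μ τ T S ZT ZS :=
  ⟨h.measT, h.measS, h.measZT, h.measZS, h.lawT, h.lawS,
    h.indep.comp measurable_swap measurable_swap, h.indepZ.symm⟩

theorem indep_prodMk_left (h : IsGaussianNoise μ τ S T ZS ZT) :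
    IndepFun (fun ω => (S ω, T ω)) ZS μ :=
  h.indep.comp measurable_id measurable_fst

theorem indep_left (h : IsGaussianNoise μ τ S T ZS ZT) : IndepFun S ZS μ :=
  h.indep.comp measurable_fst measurable_fst

theorem indep_right (h : IsGaussianNoise μ τ S T ZS ZT) : IndepFun T ZT μ :=
  h.indep.comp measurable_snd measurable_snd

theorem indep_prodMk_noise [IsProbabilityMeasure μ] (h : IsGaussianNoise μ τ S T ZS ZT) :
    IndepFun (fun ω => ((S ω, T ω), ZS ω)) ZT μ :=
  h.indep.prodMk_assoc (by have := h.measS; have := h.measT; fun_prop) h.measZS h.measZT h.indepZ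

/-- This allows Z_T to be integrated out while X, S and T are kept. -/
theorem indep_add_prodMk [IsProbabilityMeasure μ] (h : IsGaussianNoise μ τ S T ZS ZT) :
    IndepFun (fun ω => (S ω + ZS ω, S ω, T ω)) ZT μ :=
  h.indep_prodMk_noise.comp (φ := fun p : (ℝ × ℝ) × ℝ => (p.1.1 + p.2, p.1)) (by fun_prop)
    measurable_id

end IsGaussianNoise

/-! ### Box and tail estimates -/

theorem abs_integral_le_of_forall_abs_sub_gt {f : ℝ → ℝ} {m B D : ℝ} (hB : 0 ≤ B)
    (h0 : ∀ x, ¬ |x - m| ≤ B → f x = 0) (hD : ∀ x, |x - m| ≤ B → |f x| ≤ D) :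
    |∫ x, f x| ≤ 2 * B * D := by
  rw [← setIntegral_eq_integral_of_forall_compl_eq_zero (s := Metric.closedBall m B)
    (fun x hx => h0 x (by simpa [Real.dist_eq] using hx))]
  have h := norm_setIntegral_le_of_norm_le_const (μ := (volume : Measure ℝ))
    (s := Metric.closedBall m B) (f := f) (C := D)
    (by rw [Real.volume_closedBall]; exact ENNReal.ofReal_lt_top)
    (fun x hx => hD x (by simpa [Real.dist_eq] using hx))
  rw [measureReal_def, Real.volume_closedBall, ENNReal.toReal_ofReal (by positivity)] at h
  rw [mul_comm]
  exact h

/-- Plays the role of Hölder's inequality: pointwise |G| ≤ l + |G|^(q+1)/l^q, by comparing |G| with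
l. -/
theorem setIntegral_abs_le_add_pow {Ω : Type*} [MeasurableSpace Ω] {μ : Measure Ω}
    [IsProbabilityMeasure μ] {G : Ω → ℝ} {q : ℕ} (hG : Integrable G μ)
    (hGq : Integrable (fun ω => |G ω| ^ (q + 1)) μ)
    {A : Set Ω} {l : ℝ} (hl : 0 < l) :
    ∫ ω in A, |G ω| ∂μ ≤ l * μ.real A + (∫ ω, |G ω| ^ (q + 1) ∂μ) / l ^ q := by
  have hi : Integrable (fun ω => |G ω| ^ (q + 1) / l ^ q) μ := hGq.div_const _
  have hp : ∀ ω, |G ω| ≤ l + |G ω| ^ (q + 1) / l ^ q := fun ω => by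
    rcases le_or_gt |G ω| l with h | h
    · have : 0 ≤ |G ω| ^ (q + 1) / l ^ q := by positivity
      linarith
    · have : |G ω| ≤ |G ω| ^ (q + 1) / l ^ q := by
        rw [le_div_iff₀ (by positivity), pow_succ']
        gcongr
      linarith
  calc ∫ ω in A, |G ω| ∂μ ≤ ∫ ω in A, (l + |G ω| ^ (q + 1) / l ^ q) ∂μ :=
        setIntegral_mono hG.abs.integrableOn ((integrable_const l).add hi).integrableOn hp
    _ = l * μ.real A + ∫ ω in A, |G ω| ^ (q + 1) / l ^ q ∂μ := by
        rw [integral_add (integrable_const l).integrableOn hi.integrableOn, setIntegral_const,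
          smul_eq_mul, mul_comm]
    _ ≤ l * μ.real A + ∫ ω, |G ω| ^ (q + 1) / l ^ q ∂μ := by
        exact add_le_add_right (setIntegral_le_integral hi
          (ae_of_all _ fun ω => by positivity)) _
    _ = _ := by rw [integral_div]

theorem measureReal_abs_gt_le {Ω : Type*} [MeasurableSpace Ω] {μ : Measure Ω}
    [IsProbabilityMeasure μ] {U : Ω → ℝ} {k b : ℝ} (hk : 0 ≤ k) (hb : 0 < b)
    (hU : Integrable (fun ω => |U ω| ^ k) μ) :
    μ.real {ω | b < |U ω|} ≤ (∫ ω, |U ω| ^ k ∂μ) / b ^ k := by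
  rw [le_div_iff₀ (by positivity), mul_comm]
  refine le_trans ?_ (mul_meas_ge_le_integral_of_nonneg
    (ae_of_all _ fun ω => by positivity) hU (b ^ k))
  refine mul_le_mul_of_nonneg_left (measureReal_mono fun ω hω => ?_) (by positivity)
  exact Real.rpow_le_rpow hb.le (le_of_lt hω) hk

theorem integrable_abs_rpow_gaussianReal (τ : ℝ≥0) {k : ℝ} (hk : 0 < k) :
    Integrable (fun z : ℝ => |z| ^ k) (gaussianReal 0 τ) := by
  have h := (memLp_id_gaussianReal (μ := 0) (v := τ) k.toNNReal).integrable_norm_rpow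
    (by simpa using hk) (by simp)
  simpa [hk.le] using h

/-! ### Decorrelation of the noise from functions of both variables -/

section noise

variable {Ω : Type*} [MeasurableSpace Ω] {μ : Measure Ω} {τ : ℝ≥0}
  {S T ZS ZT : Ω → ℝ}

theorem integrable_noise_pow {Z : Ω → ℝ} (hZ : Measurable Z)
    (hlaw : HasLaw Z (gaussianReal 0 τ) μ) (q : ℕ) :
    Integrable (fun ω => |-(Z ω / τ)| ^ q) μ := by
  have h := integrable_gaussMoment τ q
  rw [← hlaw.map_eq, integrable_map_measure (Measurable.aestronglyMeasurable (by fun_prop))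
    (by fun_prop)] at h
  refine h.congr (ae_of_all _ fun ω => ?_)
  simp [abs_div]

theorem integral_noise_pow {Z : Ω → ℝ} (hZ : Measurable Z)
    (hlaw : HasLaw Z (gaussianReal 0 τ) μ) (q : ℕ) :
    ∫ ω, |-(Z ω / τ)| ^ q ∂μ = gaussMoment τ q := by
  rw [gaussMoment, ← hlaw.map_eq, integral_map (by fun_prop)
    (Measurable.aestronglyMeasurable (by fun_prop))]
  simp [abs_div]

theorem memLp_of_integrable_abs_pow {f : Ω → ℝ} (hf : Measurable f)
    (h : ∀ q : ℕ, Integrable (fun ω => |f ω| ^ q) μ) (q : ℕ) : MemLp f q μ := by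
  rcases Nat.eq_zero_or_pos q with rfl | hq
  · simpa using hf.aestronglyMeasurable
  rw [← integrable_norm_rpow_iff hf.aestronglyMeasurable (by simpa using hq.ne') (by simp)]
  simpa using h q

theorem memLp_noise {Z : Ω → ℝ} (hZ : Measurable Z) (hlaw : HasLaw Z (gaussianReal 0 τ) μ)
    (q : ℕ) : MemLp (fun ω => -(Z ω / τ)) q μ :=
  memLp_of_integrable_abs_pow (by fun_prop) (integrable_noise_pow hZ hlaw) q

theorem memLp_gaussScore [IsProbabilityMeasure μ] {V Z : Ω → ℝ} (hτ : 0 < τ) (hV : Measurable V) (hZ : Measurable Z)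
    (hlaw : HasLaw Z (gaussianReal 0 τ) μ) (hi : IndepFun V Z μ) (q : ℕ) :
    MemLp (fun ω => gaussScore τ (μ.map V) ((V + Z) ω)) q μ := by
  have : IsProbabilityMeasure (μ.map V) := Measure.isProbabilityMeasure_map hV.aemeasurable
  have hs := (continuous_gaussScore hτ (μ.map V)).measurable
  exact memLp_of_integrable_abs_pow (by fun_prop) (integrable_gaussScore_pow hτ hV hZ hlaw hi) q

/-- The part of the decorrelation estimate over a box. -/
theorem abs_integral_box_le [IsProbabilityMeasure μ] (hτ : 0 < τ) (h : IsGaussianNoise μ τ S T ZS ZT) {C₀ C₁ : ℝ}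
    (hC₀ : 0 < C₀) (hC₁ : 0 < C₁) (hφ₀ : ∀ u, gaussianPDFReal 0 τ u ≤ C₀)
    (hφ₁ : ∀ u, |u| / τ * gaussianPDFReal 0 τ u ≤ C₁) {m n B L₁ L₂ : ℝ} (hB : 0 ≤ B) (hL₁ : 0 ≤ L₁)
    (hρ : ∀ x, |x - m| ≤ B → |gaussScore τ (μ.map S) x| ≤ L₁) {r : ℝ × ℝ → ℝ} (hrm : Measurable r)
    (hr : ∀ p, |r p| ≤ L₂) (hr0 : ∀ p : ℝ × ℝ, ¬ (|p.1 - m| ≤ B ∧ |p.2 - n| ≤ B) → r p = 0) :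
    |∫ ω, (-(ZS ω / τ) - gaussScore τ (μ.map S) ((S + ZS) ω)) * r ((S + ZS) ω, (T + ZT) ω) ∂μ|
      ≤ 2 * B * (2 * B * (4 * (C₁ + L₁ * C₀) * C₀ * alphaMixing μ S T * L₂)) := by
  have hτ' : (0 : ℝ) < τ := hτ
  have hmS := h.measS
  have hmT := h.measT
  have hmZS := h.measZS
  have hmZT := h.measZT
  have : IsProbabilityMeasure (μ.map S) := Measure.isProbabilityMeasure_map hmS.aemeasurable
  set ρ := gaussScore τ (μ.map S) with hρdef
  have hρm : Measurable ρ := (continuous_gaussScore hτ (μ.map S)).measurable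
  have hφm := measurable_gaussianPDFReal 0 τ
  have hL₂ : 0 ≤ L₂ := (abs_nonneg _).trans (hr (0, 0))
  have hN : Integrable (fun ω => -(ZS ω / τ) - ρ ((S + ZS) ω)) μ :=
    memLp_one_iff_integrable.1 (by exact_mod_cast ((memLp_noise hmZS h.lawS 1).sub
      (memLp_gaussScore hτ hmS hmZS h.lawS h.indep_left 1)))
  -- The noise is removed in two stages: Z_T here, with X frozen, then Z_S for each fixed y. What
  -- remains is an integral over (x, y) of expectations in S and T only.
  have h1 := integral_add_gaussian hτ (V := fun ω => (S ω + ZS ω, S ω, T ω)) (Z := ZT)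
    (f := fun p => p.2.2) (by fun_prop) hmZT (by fun_prop) h.lawT h.indep_add_prodMk
    (g := fun p : ℝ × (ℝ × ℝ × ℝ) => (-((p.2.1 - p.2.2.1) / τ) - ρ p.2.1) * r (p.2.1, p.1))
    (by fun_prop) (by
      simp only [add_sub_cancel_left]
      exact hN.mul_bdd (c := L₂) (Measurable.aestronglyMeasurable (by fun_prop))
        (ae_of_all _ fun ω => hr _))
  have h2 : ∀ y, ∫ ω, gaussianPDFReal 0 τ (y - T ω) *
        ((-((S ω + ZS ω - S ω) / τ) - ρ (S ω + ZS ω)) * r (S ω + ZS ω, y)) ∂μ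
      = ∫ x, ∫ ω, gaussianPDFReal 0 τ (x - S ω) * (gaussianPDFReal 0 τ (y - T ω) *
        ((-((x - S ω) / τ) - ρ x) * r (x, y))) ∂μ := fun y => by
    refine integral_add_gaussian hτ (V := fun ω => (S ω, T ω)) (Z := ZS)
      (f := fun p => p.1) (by fun_prop) hmZS (by fun_prop) h.lawS h.indep_prodMk_left
      (g := fun p : ℝ × (ℝ × ℝ) => gaussianPDFReal 0 τ (y - p.2.2) *
        ((-((p.1 - p.2.1) / τ) - ρ p.1) * r (p.1, y))) (by fun_prop) ?_
    simp only [add_sub_cancel_left]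
    refine Integrable.bdd_mul (c := C₀) ?_ (Measurable.aestronglyMeasurable (by fun_prop))
      (ae_of_all _ fun ω => ?_)
    · exact hN.mul_bdd (c := L₂) (Measurable.aestronglyMeasurable (by fun_prop))
        (ae_of_all _ fun ω => hr _)
    · rw [Real.norm_eq_abs, abs_of_nonneg (gaussianPDFReal_nonneg _ _ _)]
      exact hφ₀ _
  have h3 : ∀ x y, |x - m| ≤ B → |∫ ω, gaussianPDFReal 0 τ (x - S ω) *
        (gaussianPDFReal 0 τ (y - T ω) * ((-((x - S ω) / τ) - ρ x) * r (x, y))) ∂μ|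
      ≤ 4 * (C₁ + L₁ * C₀) * C₀ * alphaMixing μ S T * L₂ := fun x y hx => by
    -- The identity ρp = p' at x says exactly that this function of S is centred, as the covariance
    -- inequality needs.
    have hF0 : ∫ ω, (-((x - S ω) / τ) - ρ x) * gaussianPDFReal 0 τ (x - S ω) ∂μ = 0 := by
      have e : ∫ v, (-((x - v) / τ) - ρ x) * gaussianPDFReal 0 τ (x - v) ∂(μ.map S) = 0 := by
        simp_rw [sub_mul]
        rw [integral_sub (integrable_gaussSmoothDeriv hτ _ x)
          ((integrable_gaussSmooth hτ _ x).const_mul _), integral_const_mul, sub_eq_zero]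
        exact (gaussScore_mul_gaussSmooth hτ (μ.map S) x).symm
      rwa [integral_map (by fun_prop) (Measurable.aestronglyMeasurable (by fun_prop))] at e
    have h4 := abs_integral_mul_le_alphaMixing (μ := μ) hmS hmT
      (F := fun s => (-((x - s) / τ) - ρ x) * gaussianPDFReal 0 τ (x - s))
      (G := fun t => gaussianPDFReal 0 τ (y - t)) (L := C₁ + L₁ * C₀) (L' := C₀) (by fun_prop)
      (by fun_prop) (by positivity) hC₀ (fun s => by
        have hs := gaussianPDFReal_nonneg 0 τ (x - s)
        rw [abs_mul, abs_of_nonneg hs]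
        calc _ ≤ (|x - s| / τ + |ρ x|) * gaussianPDFReal 0 τ (x - s) := by
              gcongr
              refine (abs_sub _ _).trans (le_of_eq ?_)
              rw [abs_neg, abs_div, abs_of_pos hτ']
          _ ≤ C₁ + L₁ * C₀ := by
              rw [add_mul]
              exact add_le_add (hφ₁ _) (mul_le_mul (hρ x hx) (hφ₀ _) hs hL₁))
      (fun t => by
        rw [abs_of_nonneg (gaussianPDFReal_nonneg _ _ _)]
        exact hφ₀ _) hF0
    have e : ∀ ω, gaussianPDFReal 0 τ (x - S ω) *
        (gaussianPDFReal 0 τ (y - T ω) * ((-((x - S ω) / τ) - ρ x) * r (x, y)))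
        = (-((x - S ω) / τ) - ρ x) * gaussianPDFReal 0 τ (x - S ω) *
          gaussianPDFReal 0 τ (y - T ω) * r (x, y) := fun ω => by ring
    simp_rw [e]
    rw [integral_mul_const, abs_mul]
    exact mul_le_mul h4 (hr _) (abs_nonneg _) ((abs_nonneg _).trans h4)
  have e : ∫ ω, (-(ZS ω / τ) - ρ ((S + ZS) ω)) * r ((S + ZS) ω, (T + ZT) ω) ∂μ
      = ∫ y, ∫ x, ∫ ω, gaussianPDFReal 0 τ (x - S ω) * (gaussianPDFReal 0 τ (y - T ω) *
        ((-((x - S ω) / τ) - ρ x) * r (x, y))) ∂μ := by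
    simp_rw [← h2]
    rw [← h1]
    simp
  rw [e]
  refine abs_integral_le_of_forall_abs_sub_gt (m := n) hB (fun y hy => ?_) (fun y _ =>
    abs_integral_le_of_forall_abs_sub_gt (m := m) hB (fun x hx => ?_) (fun x hx => h3 x y hx))
  · have : ∀ x, r (x, y) = 0 := fun x => hr0 _ fun h => hy h.2
    simp [this]
  · have : r (x, y) = 0 := hr0 _ fun h => hx h.1
    simp [this]

/-- A function of `X, Y` that grows linearly about `(m, n)` and has the moments of a Gaussian
score. -/
structure HasScoreBounds (μ : Measure Ω) (τ : ℝ≥0) (L m n : ℝ) (X Y : Ω → ℝ) (r : ℝ × ℝ → ℝ) :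
    Prop where
  meas : Measurable r
  growth : ∀ p : ℝ × ℝ, |r p| ≤ L * (1 + |p.1 - m| + |p.2 - n|)
  integrable : ∀ q : ℕ, Integrable (fun ω => |r (X ω, Y ω)| ^ q) μ
  moment : ∀ q : ℕ, ∫ ω, |r (X ω, Y ω)| ^ q ∂μ ≤ gaussMoment τ q

theorem abs_sub_mul_pow_le (a b c : ℝ) (n : ℕ) :
    |(a - b) * c| ^ n ≤ 2 ^ (2 * n) * (|a| ^ (2 * n) + |b| ^ (2 * n)) + |c| ^ (2 * n) := by
  have h1 : |a - b| ^ (2 * n) ≤ 2 ^ (2 * n) * (|a| ^ (2 * n) + |b| ^ (2 * n)) := by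
    calc |a - b| ^ (2 * n) ≤ (|a| + |b|) ^ (2 * n) := by gcongr; exact abs_sub _ _
      _ ≤ 2 ^ (2 * n - 1) * (|a| ^ (2 * n) + |b| ^ (2 * n)) :=
          add_pow_le (abs_nonneg _) (abs_nonneg _) _
      _ ≤ _ := by gcongr <;> norm_num
  have h2 : |(a - b) * c| ^ n ≤ |a - b| ^ (2 * n) + |c| ^ (2 * n) := by
    rw [abs_mul, mul_pow, mul_comm 2 n, pow_mul, pow_mul]
    nlinarith [sq_nonneg (|a - b| ^ n - |c| ^ n), sq_nonneg (|a - b| ^ n), sq_nonneg (|c| ^ n)]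
  linarith

/-- The bound involves only τ and q; this uniformity in S and T makes the tail estimate uniform. -/
theorem integrable_sub_mul_pow [IsProbabilityMeasure μ] (hτ : 0 < τ) (h : IsGaussianNoise μ τ S T ZS ZT)
    {L m n : ℝ} {r : ℝ × ℝ → ℝ} (hr : HasScoreBounds μ τ L m n (S + ZS) (T + ZT) r) (q : ℕ) :
    Integrable (fun ω => |(-(ZS ω / τ) - gaussScore τ (μ.map S) ((S + ZS) ω)) *
      r ((S + ZS) ω, (T + ZT) ω)| ^ q) μ ∧
    ∫ ω, |(-(ZS ω / τ) - gaussScore τ (μ.map S) ((S + ZS) ω)) *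
      r ((S + ZS) ω, (T + ZT) ω)| ^ q ∂μ ≤ (2 ^ (2 * q) * 2 + 1) * gaussMoment τ (2 * q) := by
  have hmS := h.measS
  have hmT := h.measT
  have hmZS := h.measZS
  have hmZT := h.measZT
  have hrm := hr.meas
  have : IsProbabilityMeasure (μ.map S) := Measure.isProbabilityMeasure_map hmS.aemeasurable
  have hρm := (continuous_gaussScore hτ (μ.map S)).measurable
  have i1 := integrable_noise_pow hmZS h.lawS (2 * q)
  have i2 := integrable_gaussScore_pow hτ hmS hmZS h.lawS h.indep_left (2 * q)
  have i3 := hr.integrable (2 * q)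
  have i12 : Integrable (fun ω => 2 ^ (2 * q) * (|-(ZS ω / τ)| ^ (2 * q) +
      |gaussScore τ (μ.map S) ((S + ZS) ω)| ^ (2 * q))) μ := (i1.add i2).const_mul (2 ^ (2 * q))
  have hi : Integrable (fun ω => |(-(ZS ω / τ) - gaussScore τ (μ.map S) ((S + ZS) ω)) *
      r ((S + ZS) ω, (T + ZT) ω)| ^ q) μ := by
    refine (i12.add i3).mono' (Measurable.aestronglyMeasurable (by fun_prop))
      (ae_of_all _ fun ω => ?_)
    rw [Real.norm_eq_abs, abs_of_nonneg (by positivity)]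
    exact abs_sub_mul_pow_le _ _ _ q
  refine ⟨hi, (integral_mono hi (i12.add i3) fun ω => abs_sub_mul_pow_le _ _ _ q).trans ?_⟩
  rw [integral_add' i12 i3, integral_const_mul, integral_add i1 i2, integral_noise_pow hmZS h.lawS]
  have h1 := integral_gaussScore_pow_le hτ hmS hmZS h.lawS h.indep_left (2 * q)
  have h2 := hr.moment (2 * q)
  calc _ ≤ 2 ^ (2 * q) * (gaussMoment τ (2 * q) + gaussMoment τ (2 * q)) + gaussMoment τ (2 * q) := by
        gcongr
    _ = _ := by ring

end noise

/-! ### Choice of the box size, and the decorrelation estimate -/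

/-- B = α^(-1/(k+4)) makes αB⁴ equal to B^(-k). The loss η = min ε 1 in the exponent of B becomes
η/(k+4) ≤ ε in that of α; the cap at 1 keeps η below k. -/
theorem le_rpow_of_forall_le {α C k ε E : ℝ} (hα0 : 0 ≤ α) (hα1 : α ≤ 1) (hC : 0 ≤ C) (hk : 1 < k)
    (hε : 0 < ε) (h : ∀ B : ℝ, 1 ≤ B → E ≤ C * (α * B ^ 4 + B ^ (min ε 1 - k))) :
    E ≤ 2 * C * α ^ (k / (k + 4) - ε) := by
  have hη1 : min ε 1 ≤ 1 := min_le_right _ _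
  have hηε : min ε 1 ≤ ε := min_le_left _ _
  have hη0 : 0 < min ε 1 := lt_min hε one_pos
  rcases hα0.eq_or_lt with rfl | hα
  -- For α = 0 no finite B balances. Letting B tend to infinity gives E ≤ 0, which suffices whatever
  -- the sign of the final exponent.
  · have hlim : Filter.Tendsto (fun B : ℝ => C * (0 * B ^ 4 + B ^ (min ε 1 - k))) Filter.atTop
        (nhds (C * 0)) := by
      refine Filter.Tendsto.const_mul _ ?_
      have := tendsto_rpow_neg_atTop (show 0 < k - min ε 1 by linarith)
      simpa using this
    have hE : E ≤ C * 0 := ge_of_tendsto hlim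
      (Filter.eventually_atTop.2 ⟨1, fun B hB => h B hB⟩)
    have : 0 ≤ 2 * C * (0 : ℝ) ^ (k / (k + 4) - ε) := by positivity
    linarith
  · have hk4 : 0 < k + 4 := by linarith
    have hB : 1 ≤ α ^ (-(1 / (k + 4))) :=
      Real.one_le_rpow_of_pos_of_le_one_of_nonpos hα hα1 (by
        rw [neg_nonpos]
        positivity)
    refine (h _ hB).trans ?_
    have e1 : α * (α ^ (-(1 / (k + 4)))) ^ 4 = α ^ (k / (k + 4)) := by
      rw [← Real.rpow_natCast, ← Real.rpow_mul hα0]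
      nth_rewrite 1 [← Real.rpow_one α]
      rw [← Real.rpow_add hα]
      congr 1
      field_simp
      norm_num
    have e2 : (α ^ (-(1 / (k + 4)))) ^ (min ε 1 - k) = α ^ ((k - min ε 1) / (k + 4)) := by
      rw [← Real.rpow_mul hα0]
      congr 1
      field_simp
      ring
    have i1 : α ^ (k / (k + 4)) ≤ α ^ (k / (k + 4) - ε) :=
      Real.rpow_le_rpow_of_exponent_ge hα hα1 (by linarith)
    have i2 : α ^ ((k - min ε 1) / (k + 4)) ≤ α ^ (k / (k + 4) - ε) := by
      refine Real.rpow_le_rpow_of_exponent_ge hα hα1 ?_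
      rw [sub_div, sub_le_sub_iff_left, div_le_iff₀ hk4]
      nlinarith
    rw [e1, e2]
    nlinarith

theorem measureReal_abs_add_gt_le {Ω : Type*} [MeasurableSpace Ω] {μ : Measure Ω}
    [IsProbabilityMeasure μ] {τ : ℝ≥0} {V Z : Ω → ℝ} {m k M B : ℝ} (hk : 0 < k) (hB : 0 < B)
    (hZ : Measurable Z) (hlaw : HasLaw Z (gaussianReal 0 τ) μ)
    (hV : Integrable (fun ω => |V ω - m| ^ k) μ) (hM : ∫ ω, |V ω - m| ^ k ∂μ ≤ M) :
    μ.real {ω | B < |(V + Z) ω - m|}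
      ≤ (M + ∫ z, |z| ^ k ∂(gaussianReal 0 τ)) / (B / 2) ^ k := by
  have hZk := integrable_abs_rpow_gaussianReal τ hk
  rw [← hlaw.map_eq, integrable_map_measure (Measurable.aestronglyMeasurable (by fun_prop))
    hZ.aemeasurable] at hZk
  have hZi : ∫ z, |z| ^ k ∂(gaussianReal 0 τ) = ∫ ω, |Z ω| ^ k ∂μ := by
    rw [← hlaw.map_eq, integral_map hZ.aemeasurable
      (Measurable.aestronglyMeasurable (by fun_prop))]
  have h1 := measureReal_abs_gt_le (b := B / 2) hk.le (by positivity) hV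
  have h2 := measureReal_abs_gt_le (b := B / 2) hk.le (by positivity) hZk
  have hsub : {ω | B < |(V + Z) ω - m|} ⊆ {ω | B / 2 < |V ω - m|} ∪ {ω | B / 2 < |Z ω|} := by
    intro ω hω
    by_contra hc
    simp only [Set.mem_union, Set.mem_ofPred_eq, not_or, not_lt] at hc
    have h3 : B < |(V + Z) ω - m| := hω
    have h4 : |(V + Z) ω - m| ≤ |V ω - m| + |Z ω| := by
      rw [Pi.add_apply, add_sub_right_comm]
      exact abs_add_le _ _
    linarith [hc.1, hc.2]
  calc μ.real {ω | B < |(V + Z) ω - m|}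
      ≤ μ.real {ω | B / 2 < |V ω - m|} + μ.real {ω | B / 2 < |Z ω|} :=
        (measureReal_mono hsub).trans (measureReal_union_le _ _)
    _ ≤ (∫ ω, |V ω - m| ^ k ∂μ) / (B / 2) ^ k + (∫ ω, |Z ω| ^ k ∂μ) / (B / 2) ^ k :=
        add_le_add h1 h2
    _ ≤ _ := by
        rw [← add_div, hZi]
        gcongr

-- The integrand is split according to whether (X, Y) lies in the box of half-side B about (m, n).
-- The constant is fixed before the centres are, so they may later be the means, on which no bound
-- is assumed.
set_option maxHeartbeats 600000 in
theorem exists_decorrelation_const {τ : ℝ≥0} (hτ : 0 < τ) {L k η : ℝ} (M : ℝ) (hL : 0 ≤ L)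
    (hk : 0 < k) (hη : 0 < η) :
    ∃ C : ℝ, 0 ≤ C ∧ ∀ (Ω : Type*) [MeasurableSpace Ω] (μ : Measure Ω) [IsProbabilityMeasure μ]
      (S T ZS ZT : Ω → ℝ), IsGaussianNoise μ τ S T ZS ZT → ∀ m n : ℝ,
      Integrable (fun ω => |S ω - m| ^ k) μ → Integrable (fun ω => |T ω - n| ^ k) μ →
      ∫ ω, |S ω - m| ^ k ∂μ ≤ M → ∫ ω, |T ω - n| ^ k ∂μ ≤ M →
      (∀ x, |gaussScore τ (μ.map S) x| ≤ L * (1 + |x - m|)) →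
      ∀ r : ℝ × ℝ → ℝ, HasScoreBounds μ τ L m n (S + ZS) (T + ZT) r → ∀ B : ℝ, 1 ≤ B →
      |∫ ω, (-(ZS ω / τ) - gaussScore τ (μ.map S) ((S + ZS) ω)) *
        r ((S + ZS) ω, (T + ZT) ω) ∂μ| ≤ C * (alphaMixing μ S T * B ^ 4 + B ^ (η - k)) := by
  have hτ' : (0 : ℝ) < τ := hτ
  obtain ⟨c₀, hc₀⟩ := abs_pow_mul_gaussianPDFReal_le hτ 0
  obtain ⟨c₁, hc₁⟩ := abs_pow_mul_gaussianPDFReal_le hτ 1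
  set C₀ := max c₀ 1 with hC₀def
  set C₁ := max (c₁ / τ) 1 with hC₁def
  have hC₀ : 0 < C₀ := lt_max_of_lt_right one_pos
  have hC₁ : 0 < C₁ := lt_max_of_lt_right one_pos
  have hφ₀ : ∀ u, gaussianPDFReal 0 τ u ≤ C₀ := fun u => by
    have := hc₀ u
    rw [pow_zero, one_mul] at this
    exact this.trans (le_max_left _ _)
  have hφ₁ : ∀ u, |u| / τ * gaussianPDFReal 0 τ u ≤ C₁ := fun u => by
    refine le_trans ?_ (le_max_left _ _)
    rw [div_mul_eq_mul_div]
    have := hc₁ u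
    rw [pow_one] at this
    gcongr
  set a := ∫ z, |z| ^ k ∂(gaussianReal 0 τ) with ha
  have ha0 : 0 ≤ a := integral_nonneg fun z => by positivity
  -- With truncation level B^η, the moment of order q + 1 is divided by B^(ηq) ≥ B^k.
  set q := ⌈k / η⌉₊ with hq
  have hqk : k ≤ η * q := by
    rw [mul_comm, ← div_le_iff₀ hη]
    exact Nat.le_ceil _
  set Mq := (2 ^ (2 * (q + 1)) * 2 + 1) * gaussMoment τ (2 * (q + 1)) with hMq
  have hMq0 : 0 ≤ Mq := mul_nonneg (by positivity) (gaussMoment_nonneg _ _)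
  set Cb := 2 * (2 * (4 * (C₁ + 2 * L * C₀) * C₀ * (3 * L))) with hCb
  have hCb0 : 0 ≤ Cb := by positivity
  -- `M` may be negative, whereas the constant must be nonnegative in every case.
  set Ct := 2 * (max M 0 + a) * 2 ^ k with hCt
  have hCt0 : 0 ≤ Ct := by positivity
  refine ⟨Cb + (Ct + Mq), by positivity, ?_⟩
  intro Ω _ μ _ S T ZS ZT h m n hSi hTi hSM hTM hρ r hr B hB
  have hB0 : 0 < B := by linarith
  have hmS := h.measS
  have hmT := h.measT
  have hmZS := h.measZS
  have hmZT := h.measZT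
  have hrm := hr.meas
  have : IsProbabilityMeasure (μ.map S) := Measure.isProbabilityMeasure_map hmS.aemeasurable
  have hα := alphaMixing_nonneg μ S T
  set ρ := gaussScore τ (μ.map S) with hρdef
  have hρm : Measurable ρ := (continuous_gaussScore hτ (μ.map S)).measurable
  set G : Ω → ℝ := fun ω => (-(ZS ω / τ) - ρ ((S + ZS) ω)) * r ((S + ZS) ω, (T + ZT) ω) with hG
  have hGm : Measurable G := by fun_prop
  have hGi : Integrable G μ := by
    have := (integrable_sub_mul_pow hτ h hr 1).1
    simp only [pow_one] at this
    exact (integrable_norm_iff hGm.aestronglyMeasurable).1 this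
  obtain ⟨hGq, hGM⟩ := integrable_sub_mul_pow hτ h hr (q + 1)
  set Q : Set (ℝ × ℝ) := {p | |p.1 - m| ≤ B ∧ |p.2 - n| ≤ B} with hQ
  have hQm : MeasurableSet Q :=
    (measurableSet_le (f := fun p : ℝ × ℝ => |p.1 - m|) (by fun_prop) measurable_const).inter
      (measurableSet_le (f := fun p : ℝ × ℝ => |p.2 - n|) (by fun_prop) measurable_const)
  set A : Set Ω := {ω | ¬ ((S + ZS) ω, (T + ZT) ω) ∈ Q} with hA
  have hAm : MeasurableSet A :=
    (hQm.preimage (f := fun ω => ((S + ZS) ω, (T + ZT) ω)) (by fun_prop)).compl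
  have hPA : μ.real A ≤ Ct * B ^ (-k) := by
    have hsub : A ⊆ {ω | B < |(S + ZS) ω - m|} ∪ {ω | B < |(T + ZT) ω - n|} := fun ω hω => by
      by_contra hc
      simp only [Set.mem_union, Set.mem_ofPred_eq, not_or, not_lt] at hc
      exact hω hc
    refine (measureReal_mono hsub).trans ((measureReal_union_le _ _).trans
      ((add_le_add (measureReal_abs_add_gt_le hk hB0 hmZS h.lawS hSi (hSM.trans (le_max_left M 0)))
      (measureReal_abs_add_gt_le hk hB0 hmZT h.lawT hTi (hTM.trans (le_max_left M 0)))).trans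
        (le_of_eq ?_)))
    rw [Real.div_rpow hB0.le two_pos.le, Real.rpow_neg hB0.le, hCt]
    field_simp
    ring
  have htail : |∫ ω in A, G ω ∂μ| ≤ (Ct + Mq) * B ^ (η - k) := by
    have h1 := setIntegral_abs_le_add_pow hGi hGq (A := A) (l := B ^ η) (by positivity)
    refine abs_integral_le_integral_abs.trans (h1.trans ?_)
    have h2 : B ^ η * μ.real A ≤ Ct * B ^ (η - k) := by
      calc B ^ η * μ.real A ≤ B ^ η * (Ct * B ^ (-k)) := by gcongr
        _ = Ct * B ^ (η - k) := by rw [sub_eq_add_neg, Real.rpow_add hB0]; ring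
    have h3 : (∫ ω, |G ω| ^ (q + 1) ∂μ) / (B ^ η) ^ q ≤ Mq * B ^ (η - k) := by
      rw [← Real.rpow_natCast, ← Real.rpow_mul hB0.le, div_eq_mul_inv, ← Real.rpow_neg hB0.le]
      refine mul_le_mul hGM (Real.rpow_le_rpow_of_exponent_le hB (by linarith)) (by positivity) hMq0
    linarith
  have hbox : |∫ ω in Aᶜ, G ω ∂μ| ≤ Cb * (alphaMixing μ S T * B ^ 4) := by
    have e : ∫ ω in Aᶜ, G ω ∂μ = ∫ ω, (-(ZS ω / τ) - ρ ((S + ZS) ω)) *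
        Q.indicator r ((S + ZS) ω, (T + ZT) ω) ∂μ := by
      rw [← integral_indicator hAm.compl]
      refine integral_congr_ae (ae_of_all _ fun ω => ?_)
      by_cases hω : ((S + ZS) ω, (T + ZT) ω) ∈ Q
      · have : ω ∈ Aᶜ := fun hc => hc hω
        simp only [Set.indicator_of_mem this, Set.indicator_of_mem hω, hG]
      · have : ω ∉ Aᶜ := fun hc => hc hω
        simp only [Set.indicator_of_notMem this, Set.indicator_of_notMem hω, mul_zero]
    rw [e]
    -- On the box 1 + |x - m| ≤ 2B and 1 + |x - m| + |y - n| ≤ 3B, because B ≥ 1.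
    refine (abs_integral_box_le hτ h hC₀ hC₁ hφ₀ hφ₁ (m := m) (n := n) (B := B) (L₁ := 2 * L * B)
      (L₂ := 3 * L * B) hB0.le (by positivity) (fun x hx => (hρ x).trans ?_)
      (hrm.indicator hQm) (fun p => ?_) (fun p hp => Set.indicator_of_notMem (show p ∉ Q from hp) r)).trans ?_
    · nlinarith
    · by_cases hp : p ∈ Q
      · rw [Set.indicator_of_mem hp]
        refine (hr.growth p).trans ?_
        have := hp.1
        have := hp.2
        nlinarith
      · rw [Set.indicator_of_notMem hp, abs_zero]
        positivity
    · have hC : C₁ + 2 * L * B * C₀ ≤ (C₁ + 2 * L * C₀) * B := by nlinarith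
      calc 2 * B * (2 * B * (4 * (C₁ + 2 * L * B * C₀) * C₀ * alphaMixing μ S T * (3 * L * B)))
          ≤ 2 * B * (2 * B * (4 * ((C₁ + 2 * L * C₀) * B) * C₀ * alphaMixing μ S T *
            (3 * L * B))) := by gcongr
        _ = _ := by rw [hCb]; ring
  rw [← integral_add_compl hAm hGi]
  refine (abs_add_le _ _).trans ((add_le_add htail hbox).trans ?_)
  have hb0 : 0 ≤ B ^ (η - k) := by positivity
  have hb4 : 0 ≤ alphaMixing μ S T * B ^ 4 := by positivity
  have : 0 ≤ Cb * B ^ (η - k) := by positivity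
  have : 0 ≤ (Ct + Mq) * (alphaMixing μ S T * B ^ 4) := by positivity
  nlinarith

/-! ### The mixture of the two variables -/

/-- Supplies the mass hypothesis of `abs_gaussScore_le`. The form with two variables covers S, T and
their mixture at once. -/
theorem half_le_map_real {Ω : Type*} [MeasurableSpace Ω] {μ : Measure Ω} [IsProbabilityMeasure μ]
    {V U₁ U₂ : Ω → ℝ} (hV : Measurable V) {c R : ℝ}
    (hVU : ∀ ω, |V ω - c| ≤ |U₁ ω| + |U₂ ω|) (h₁ : μ.real {ω | R < |U₁ ω|} ≤ 1 / 4)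
    (h₂ : μ.real {ω | R < |U₂ ω|} ≤ 1 / 4) :
    1 / 2 ≤ (μ.map V).real {v | |v - c| ≤ 2 * R} := by
  have hm : MeasurableSet {v : ℝ | |v - c| ≤ 2 * R} :=
    measurableSet_le (by fun_prop) measurable_const
  rw [map_measureReal_apply hV hm]
  have hsub : (V ⁻¹' {v | |v - c| ≤ 2 * R})ᶜ ⊆ {ω | R < |U₁ ω|} ∪ {ω | R < |U₂ ω|} := by
    intro ω hω
    by_contra hc
    simp only [Set.mem_union, Set.mem_ofPred_eq, not_or, not_lt] at hc
    refine hω ?_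
    have := hVU ω
    show |V ω - c| ≤ 2 * R
    linarith [hc.1, hc.2]
  have h := (measureReal_mono (μ := μ) hsub).trans (measureReal_union_le _ _)
  rw [probReal_compl_eq_one_sub (hV hm)] at h
  linarith

theorem measurable_mix {Ω : Type*} [MeasurableSpace Ω] {β : ℝ} {X Y : Ω → ℝ} (hX : Measurable X) (hY : Measurable Y) :
    Measurable (mix β X Y) := by
  unfold mix
  fun_prop

theorem mix_add {Ω : Type*} (β : ℝ) (S T ZS ZT : Ω → ℝ) :
    mix β (S + ZS) (T + ZT) = mix β S T + mix β ZS ZT := by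
  funext ω
  simp only [mix, Pi.add_apply]
  ring

namespace IsGaussianNoise

variable {Ω : Type*} [MeasurableSpace Ω] {μ : Measure Ω} {τ : ℝ≥0} {S T ZS ZT : Ω → ℝ}

theorem indep_mix (h : IsGaussianNoise μ τ S T ZS ZT) (β : ℝ) :
    IndepFun (mix β S T) (mix β ZS ZT) μ :=
  h.indep.comp (φ := fun p : ℝ × ℝ => Real.sqrt β * p.1 + Real.sqrt (1 - β) * p.2)
    (ψ := fun p : ℝ × ℝ => Real.sqrt β * p.1 + Real.sqrt (1 - β) * p.2) (by fun_prop) (by fun_prop)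

/-- The variance is βτ + (1 - β)τ = τ, so the mixture of X and Y is a smoothing at the same scale
and everything about scores applies to it. -/
theorem hasLaw_mix [IsProbabilityMeasure μ] (h : IsGaussianNoise μ τ S T ZS ZT) {β : ℝ}
    (h0 : 0 ≤ β) (h1 : β ≤ 1) : HasLaw (mix β ZS ZT) (gaussianReal 0 τ) μ := by
  refine ⟨(measurable_mix h.measZS h.measZT).aemeasurable, ?_⟩
  have hi : IndepFun (fun ω => Real.sqrt β * ZS ω) (fun ω => Real.sqrt (1 - β) * ZT ω) μ :=
    h.indepZ.comp (φ := fun z => Real.sqrt β * z) (ψ := fun z => Real.sqrt (1 - β) * z)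
      (by fun_prop) (by fun_prop)
  have hX := gaussianReal_const_mul h.lawS (Real.sqrt β)
  have hY := gaussianReal_const_mul h.lawT (Real.sqrt (1 - β))
  have e := gaussianReal_add_gaussianReal_of_indepFun hi hX.map_eq hY.map_eq
  have hmix : mix β ZS ZT = (fun ω => Real.sqrt β * ZS ω) + (fun ω => Real.sqrt (1 - β) * ZT ω) :=
    rfl
  rw [hmix, e]
  congr 1
  · simp
  · ext
    push_cast
    rw [Real.sq_sqrt h0, Real.sq_sqrt (by linarith)]
    ring

end IsGaussianNoise

/-! ### Expansion of the squared score gap -/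

section gap

variable {Ω : Type*} [MeasurableSpace Ω] {μ : Measure Ω} {τ : ℝ≥0}

theorem hasFiniteFisherInfo_add_gaussian [IsProbabilityMeasure μ] (hτ : 0 < τ) {V Z : Ω → ℝ} (hV : Measurable V)
    (hZ : Measurable Z) (hlaw : HasLaw Z (gaussianReal 0 τ) μ) (hi : IndepFun V Z μ) :
    HasFiniteFisherInfo μ (V + Z) := by
  refine ⟨⟨_, hasSmoothDensity_add_gaussian hτ hV hZ hlaw hi⟩, ?_⟩
  rw [score_add_gaussian hτ hV hZ hlaw hi]
  exact (memLp_gaussScore hτ hV hZ hlaw hi 2).integrable_sq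

/-- In each cross term a score is replaced by its noise, at the price of an error. The noise parts
against fW add up to E fW² by `hWW`, which turns +E fW² into -E fW²; the noise part against fX
vanishes by `hTX`. -/
theorem integral_sq_sub_eq {fX fY fW nS nT : Ω → ℝ} {a b : ℝ}
    (hX : MemLp fX 2 μ) (hY : MemLp fY 2 μ) (hW : MemLp fW 2 μ) (hS : MemLp nS 2 μ)
    (hT : MemLp nT 2 μ) (hWW : ∫ ω, (a * nS ω + b * nT ω) * fW ω ∂μ = ∫ ω, fW ω * fW ω ∂μ)
    (hTX : ∫ ω, nT ω * fX ω ∂μ = 0) :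
    ∫ ω, (a * fX ω + b * fY ω - fW ω) ^ 2 ∂μ
      = a ^ 2 * ∫ ω, fX ω ^ 2 ∂μ + b ^ 2 * ∫ ω, fY ω ^ 2 ∂μ - ∫ ω, fW ω ^ 2 ∂μ
        + (2 * a * ∫ ω, (nS ω - fX ω) * fW ω ∂μ + 2 * b * ∫ ω, (nT ω - fY ω) * fW ω ∂μ
          - 2 * a * b * ∫ ω, (nT ω - fY ω) * fX ω ∂μ) := by
  have iXX : Integrable (fun ω => fX ω ^ 2) μ := hX.integrable_sq
  have iYY : Integrable (fun ω => fY ω ^ 2) μ := hY.integrable_sq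
  have iWW : Integrable (fun ω => fW ω ^ 2) μ := hW.integrable_sq
  have iYX : Integrable (fun ω => fY ω * fX ω) μ := hY.integrable_mul hX
  have iXW : Integrable (fun ω => fX ω * fW ω) μ := hX.integrable_mul hW
  have iYW : Integrable (fun ω => fY ω * fW ω) μ := hY.integrable_mul hW
  have iSW : Integrable (fun ω => nS ω * fW ω) μ := hS.integrable_mul hW
  have iTW : Integrable (fun ω => nT ω * fW ω) μ := hT.integrable_mul hW
  have iTX : Integrable (fun ω => nT ω * fX ω) μ := hT.integrable_mul hX
  have e1 : ∫ ω, (nS ω - fX ω) * fW ω ∂μ = ∫ ω, nS ω * fW ω ∂μ - ∫ ω, fX ω * fW ω ∂μ := by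
    simp_rw [sub_mul]
    exact integral_sub iSW iXW
  have e2 : ∫ ω, (nT ω - fY ω) * fW ω ∂μ = ∫ ω, nT ω * fW ω ∂μ - ∫ ω, fY ω * fW ω ∂μ := by
    simp_rw [sub_mul]
    exact integral_sub iTW iYW
  have e3 : ∫ ω, (nT ω - fY ω) * fX ω ∂μ = - ∫ ω, fY ω * fX ω ∂μ := by
    simp_rw [sub_mul]
    rw [integral_sub iTX iYX, hTX, zero_sub]
  have e4 : a * ∫ ω, nS ω * fW ω ∂μ + b * ∫ ω, nT ω * fW ω ∂μ = ∫ ω, fW ω ^ 2 ∂μ := by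
    simp_rw [sq]
    rw [← hWW, ← integral_const_mul, ← integral_const_mul, ← integral_add (iSW.const_mul a)
      (iTW.const_mul b)]
    congr 1
    funext ω
    ring
  have e5 : ∫ ω, (a * fX ω + b * fY ω - fW ω) ^ 2 ∂μ
      = a ^ 2 * ∫ ω, fX ω ^ 2 ∂μ + b ^ 2 * ∫ ω, fY ω ^ 2 ∂μ + ∫ ω, fW ω ^ 2 ∂μ
        + 2 * a * b * ∫ ω, fY ω * fX ω ∂μ - 2 * a * ∫ ω, fX ω * fW ω ∂μ
        - 2 * b * ∫ ω, fY ω * fW ω ∂μ := by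
    have : ∀ ω, (a * fX ω + b * fY ω - fW ω) ^ 2 = a ^ 2 * fX ω ^ 2 + b ^ 2 * fY ω ^ 2 + fW ω ^ 2
        + 2 * a * b * (fY ω * fX ω) - 2 * a * (fX ω * fW ω) - 2 * b * (fY ω * fW ω) :=
      fun ω => by ring
    simp_rw [this]
    have j1 := (iXX.const_mul (a ^ 2)).add (iYY.const_mul (b ^ 2))
    have j2 := j1.add iWW
    have j3 := j2.add (iYX.const_mul (2 * a * b))
    have j4 := j3.sub (iXW.const_mul (2 * a))
    refine (integral_sub j4 (iYW.const_mul (2 * b))).trans ?_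
    rw [integral_sub' j3 (iXW.const_mul (2 * a)),
      integral_add' j2 (iYX.const_mul (2 * a * b)), integral_add' j1 iWW,
      integral_add' (iXX.const_mul (a ^ 2)) (iYY.const_mul (b ^ 2))]
    simp only [integral_const_mul]
  rw [e5, e1, e2, e3, ← e4]
  ring

end gap

/-! ### Assembly of the estimate -/

/-- The common form of both estimates, with moments about arbitrary centres. -/
theorem exists_scoreGap_const {τ : ℝ≥0} (hτ : 0 < τ) {ε : ℝ} (hε : 0 < ε) {k : ℝ} (hk : 1 < k)
    (M : ℝ) : ∃ C : ℝ, ∀ (Ω : Type*) [MeasurableSpace Ω] (μ : Measure Ω) [IsProbabilityMeasure μ]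
      (S T ZS ZT : Ω → ℝ), IsGaussianNoise μ τ S T ZS ZT → ∀ m n : ℝ,
      Integrable (fun ω => |S ω - m| ^ k) μ → Integrable (fun ω => |T ω - n| ^ k) μ →
      ∫ ω, |S ω - m| ^ k ∂μ ≤ M → ∫ ω, |T ω - n| ^ k ∂μ ≤ M →
      ∀ β : ℝ, 0 ≤ β → β ≤ 1 →
        HasFiniteFisherInfo μ (S + ZS) ∧ HasFiniteFisherInfo μ (T + ZT) ∧
        HasFiniteFisherInfo μ (mix β (S + ZS) (T + ZT)) ∧
        Integrable (scoreGapSq μ (S + ZS) (T + ZT) β) μ ∧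
        β * fisherInfo μ (S + ZS) + (1 - β) * fisherInfo μ (T + ZT)
            - fisherInfo μ (mix β (S + ZS) (T + ZT))
            + C * alphaMixing μ S T ^ (k / (k + 4) - ε)
          ≥ scoreGap μ (S + ZS) (T + ZT) β := by
  have hk0 : 0 < k := by linarith
  -- Since R ≥ 1 and k > 1, R^k ≥ R ≥ 4M, so Markov's inequality leaves tails of at most 1/4 for S -
  -- m and T - n. `L` is the growth constant for radius 2R.
  set R := max 1 (4 * M) with hR
  have hR1 : 1 ≤ R := le_max_left _ _
  set L := (4 + 2 * (2 * R) + 2 * (τ : ℝ)) / τ with hLdef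
  have hL : 0 ≤ L := by positivity
  obtain ⟨C, hC0, hC⟩ := exists_decorrelation_const hτ M hL hk0 (lt_min hε one_pos)
  -- Three errors with coefficients at most 2 make 6; the outer 2 comes from balancing the two terms
  -- in B.
  refine ⟨2 * (6 * C), ?_⟩
  intro Ω _ μ _ S T ZS ZT h m n hSi hTi hSM hTM β hβ0 hβ1
  have hmS := h.measS
  have hmT := h.measT
  have hmZS := h.measZS
  have hmZT := h.measZT
  set a := Real.sqrt β with ha
  set b := Real.sqrt (1 - β) with hb
  have ha0 : 0 ≤ a := Real.sqrt_nonneg _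
  have hb0 : 0 ≤ b := Real.sqrt_nonneg _
  have ha2 : a ^ 2 = β := Real.sq_sqrt hβ0
  have hb2 : b ^ 2 = 1 - β := Real.sq_sqrt (by linarith)
  have ha1 : a ≤ 1 := Real.sqrt_le_one.2 hβ1
  have hb1 : b ≤ 1 := Real.sqrt_le_one.2 (by linarith)
  set V := mix β S T with hV
  set Z := mix β ZS ZT with hZ
  have hmV : Measurable V := measurable_mix hmS hmT
  have hmZ : Measurable Z := measurable_mix hmZS hmZT
  have hlZ : HasLaw Z (gaussianReal 0 τ) μ := h.hasLaw_mix hβ0 hβ1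
  have hiZ : IndepFun V Z μ := h.indep_mix β
  have hW : mix β (S + ZS) (T + ZT) = V + Z := mix_add β S T ZS ZT
  have hsX := score_add_gaussian hτ hmS hmZS h.lawS h.indep_left
  have hsY := score_add_gaussian hτ hmT hmZT h.lawT h.indep_right
  have hsW := score_add_gaussian hτ hmV hmZ hlZ hiZ
  have : IsProbabilityMeasure (μ.map S) := Measure.isProbabilityMeasure_map hmS.aemeasurable
  have : IsProbabilityMeasure (μ.map T) := Measure.isProbabilityMeasure_map hmT.aemeasurable
  have : IsProbabilityMeasure (μ.map V) := Measure.isProbabilityMeasure_map hmV.aemeasurable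
  set ρX := gaussScore τ (μ.map S) with hρX
  set ρY := gaussScore τ (μ.map T) with hρY
  set ρW := gaussScore τ (μ.map V) with hρW
  have hρXm : Measurable ρX := (continuous_gaussScore hτ (μ.map S)).measurable
  have hρWm : Measurable ρW := (continuous_gaussScore hτ (μ.map V)).measurable
  have mX : MemLp (fun ω => ρX ((S + ZS) ω)) 2 μ :=
    memLp_gaussScore hτ hmS hmZS h.lawS h.indep_left 2
  have mY : MemLp (fun ω => ρY ((T + ZT) ω)) 2 μ :=
    memLp_gaussScore hτ hmT hmZT h.lawT h.indep_right 2
  have mW : MemLp (fun ω => ρW ((V + Z) ω)) 2 μ :=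
    memLp_gaussScore hτ hmV hmZ hlZ hiZ 2
  have mS : MemLp (fun ω => -(ZS ω / τ)) 2 μ :=
    memLp_noise hmZS h.lawS 2
  have mT : MemLp (fun ω => -(ZT ω / τ)) 2 μ :=
    memLp_noise hmZT h.lawT 2
  have mZ : MemLp (fun ω => -(Z ω / τ)) 2 μ :=
    memLp_noise hmZ hlZ 2
  have hlin : ∀ ω, -(Z ω / τ) = a * -(ZS ω / τ) + b * -(ZT ω / τ) := fun ω => by
    simp only [hZ, mix]
    ring
  have hWW : ∫ ω, (a * -(ZS ω / τ) + b * -(ZT ω / τ)) * ρW ((V + Z) ω) ∂μ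
      = ∫ ω, ρW ((V + Z) ω) * ρW ((V + Z) ω) ∂μ := by
    simp_rw [← hlin]
    exact integral_mul_eq_gaussScore hτ hmV hmZ hlZ hiZ hρWm (mZ.integrable_mul mW)
  have hTX : ∫ ω, -(ZT ω / τ) * ρX ((S + ZS) ω) ∂μ = 0 := by
    have hi : IndepFun (fun ω => -(ZT ω / τ)) (fun ω => ρX ((S + ZS) ω)) μ :=
      (h.indep_add_prodMk.comp (φ := fun p : ℝ × ℝ × ℝ => ρX p.1)
        (ψ := fun z : ℝ => -(z / τ)) (by fun_prop) (by fun_prop)).symm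
    have hz : ∫ ω, -(ZT ω / τ) ∂μ = 0 := by
      rw [integral_neg, integral_div]
      have := h.lawT.integral_eq
      simp only [integral_id_gaussianReal] at this
      simp [this]
    rw [hi.integral_fun_mul_eq_mul_integral (Measurable.aestronglyMeasurable (by fun_prop))
      (Measurable.aestronglyMeasurable (by fun_prop)), hz, zero_mul]
  have hdist : ∀ U : Ω → ℝ, Integrable (fun ω => |U ω| ^ k) μ → ∫ ω, |U ω| ^ k ∂μ ≤ M →
      μ.real {ω | R < |U ω|} ≤ 1 / 4 := fun U hU hUM => by
    refine (measureReal_abs_gt_le hk0.le (by linarith) hU).trans ?_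
    have h1 : R ≤ R ^ k := by
      simpa using Real.rpow_le_rpow_of_exponent_le hR1 hk.le
    have h2 : 4 * M ≤ R := le_max_right _ _
    rw [div_le_iff₀ (by linarith)]
    linarith
  have hdS := hdist (fun ω => S ω - m) hSi hSM
  have hdT := hdist (fun ω => T ω - n) hTi hTM
  have hgX : ∀ x, |ρX x| ≤ L * (1 + |x - m|) := abs_gaussScore_le hτ _ (by linarith)
    (half_le_map_real hmS (fun ω => le_add_of_nonneg_right (abs_nonneg _)) hdS hdT)
  have hgY : ∀ x, |ρY x| ≤ L * (1 + |x - n|) := abs_gaussScore_le hτ _ (by linarith)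
    (half_le_map_real hmT (fun ω => le_add_of_nonneg_left (abs_nonneg _)) hdS hdT)
  have hmixabs : ∀ x y : ℝ, |a * x + b * y - (a * m + b * n)| ≤ |x - m| + |y - n| := fun x y => by
    calc |a * x + b * y - (a * m + b * n)| = |a * (x - m) + b * (y - n)| := by ring_nf
      _ ≤ |a * (x - m)| + |b * (y - n)| := abs_add_le _ _
      _ = a * |x - m| + b * |y - n| := by
          rw [abs_mul, abs_mul, abs_of_nonneg ha0, abs_of_nonneg hb0]
      _ ≤ 1 * |x - m| + 1 * |y - n| := by gcongr
      _ = _ := by ring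
  have hgW : ∀ x, |ρW x| ≤ L * (1 + |x - (a * m + b * n)|) := abs_gaussScore_le hτ _ (by linarith)
    (half_le_map_real hmV (fun ω => hmixabs _ _) hdS hdT)
  have hWω : ∀ ω, a * (S + ZS) ω + b * (T + ZT) ω = (V + Z) ω := fun ω => congrFun hW ω
  have r1 : HasScoreBounds μ τ L m n (S + ZS) (T + ZT) (fun p => ρW (a * p.1 + b * p.2)) := by
    refine ⟨by fun_prop, fun p => (hgW _).trans ?_, fun q => ?_, fun q => ?_⟩
    · rw [add_assoc]
      gcongr
      exact hmixabs _ _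
    · simp_rw [hWω]
      exact integrable_gaussScore_pow hτ hmV hmZ hlZ hiZ q
    · simp_rw [hWω]
      exact integral_gaussScore_pow_le hτ hmV hmZ hlZ hiZ q
  have r2 : HasScoreBounds μ τ L n m (T + ZT) (S + ZS) (fun p => ρW (a * p.2 + b * p.1)) := by
    refine ⟨by fun_prop, fun p => (hgW _).trans ?_, r1.integrable, r1.moment⟩
    rw [add_assoc, add_comm |p.1 - n|]
    gcongr
    exact hmixabs _ _
  have r3 : HasScoreBounds μ τ L n m (T + ZT) (S + ZS) (fun p => ρX p.2) := by
    refine ⟨by fun_prop, fun p => (hgX _).trans ?_,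
      integrable_gaussScore_pow hτ hmS hmZS h.lawS h.indep_left,
      integral_gaussScore_pow_le hτ hmS hmZS h.lawS h.indep_left⟩
    gcongr
    exact le_add_of_nonneg_right (abs_nonneg _)
  -- The three errors: N_S - ρ_X against ρ̃, then, with S and T exchanged, N_T - ρ_Y against ρ̃ and
  -- against ρ_X.
  have hd1 := hC Ω μ S T ZS ZT h m n hSi hTi hSM hTM hgX _ r1
  have hd2 := hC Ω μ T S ZT ZS h.swap n m hTi hSi hTM hSM hgY _ r2
  have hd3 := hC Ω μ T S ZT ZS h.swap n m hTi hSi hTM hSM hgY _ r3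
  simp only [hWω] at hd1 hd2
  rw [alphaMixing_comm μ T S] at hd2 hd3
  have hid := integral_sq_sub_eq (a := a) (b := b) mX mY mW mS mT hWW hTX
  refine ⟨hasFiniteFisherInfo_add_gaussian hτ hmS hmZS h.lawS h.indep_left,
    hasFiniteFisherInfo_add_gaussian hτ hmT hmZT h.lawT h.indep_right, ?_, ?_, ?_⟩
  · rw [hW]
    exact hasFiniteFisherInfo_add_gaussian hτ hmV hmZ hlZ hiZ
  · unfold scoreGapSq
    rw [hW, hsX, hsY, hsW]
    exact (((mX.const_mul a).add (mY.const_mul b)).sub mW).integrable_sq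
  · unfold scoreGap scoreGapSq fisherInfo
    rw [hW, hsX, hsY, hsW, hid, ha2, hb2, ge_iff_le, add_le_add_iff_left]
    refine le_rpow_of_forall_le (alphaMixing_nonneg μ S T) (alphaMixing_le_one μ S T)
      (by positivity) hk hε fun B hB => ?_
    have b1 := hd1 B hB
    have b2 := hd2 B hB
    have b3 := hd3 B hB
    set E := C * (alphaMixing μ S T * B ^ 4 + B ^ (min ε 1 - k)) with hE
    have hE0 : 0 ≤ E := (abs_nonneg _).trans b1
    have key : ∀ c x : ℝ, 0 ≤ c → c ≤ 1 → |x| ≤ E → |2 * c * x| ≤ 2 * E := fun c x h0 h1 hx => by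
      rw [abs_mul, abs_of_nonneg (by positivity)]
      nlinarith [abs_nonneg x]
    have c1 := (abs_le.1 (key a _ ha0 ha1 b1)).2
    have c2 := (abs_le.1 (key b _ hb0 hb1 b2)).2
    have c3 := (abs_le.1 (key (a * b) _ (by positivity) (mul_le_one₀ ha1 hb0 hb1) b3)).1
    rw [← mul_assoc 2 a b] at c3
    calc _ ≤ 6 * E := by linarith
      _ = _ := by rw [hE]; ring

end

theorem theorem2p2 (K : ℝ) (τ : ℝ≥0) (hτ : 0 < τ) (ε : ℝ) (hε : 0 < ε) :
    (∃ C : ℝ, ∀ (Ω : Type*) [MeasurableSpace Ω] (μ : Measure Ω) [IsProbabilityMeasure μ]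
      (S T ZS ZT : Ω → ℝ),
      Measurable S → Measurable T → Measurable ZS → Measurable ZT →
      MemLp S 2 μ → MemLp T 2 μ →
      max (variance S μ) (variance T μ) ≤ K * τ →
      HasLaw ZS (gaussianReal 0 τ) μ → HasLaw ZT (gaussianReal 0 τ) μ →
      IndepFun (fun ω => (S ω, T ω)) (fun ω => (ZS ω, ZT ω)) μ → IndepFun ZS ZT μ →
      ∀ β : ℝ, 0 ≤ β → β ≤ 1 →
        HasFiniteFisherInfo μ (S + ZS) ∧ HasFiniteFisherInfo μ (T + ZT) ∧
        HasFiniteFisherInfo μ (mix β (S + ZS) (T + ZT)) ∧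
        Integrable (scoreGapSq μ (S + ZS) (T + ZT) β) μ ∧
        β * fisherInfo μ (S + ZS) + (1 - β) * fisherInfo μ (T + ZT)
            - fisherInfo μ (mix β (S + ZS) (T + ZT))
            + C * alphaMixing μ S T ^ (1 / 3 - ε)
          ≥ scoreGap μ (S + ZS) (T + ZT) β) ∧
    (∀ k M : ℝ, 2 ≤ k →
      ∃ C : ℝ, ∀ (Ω : Type*) [MeasurableSpace Ω] (μ : Measure Ω) [IsProbabilityMeasure μ]
      (S T ZS ZT : Ω → ℝ),
      Measurable S → Measurable T → Measurable ZS → Measurable ZT →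
      MemLp S 2 μ → MemLp T 2 μ →
      max (variance S μ) (variance T μ) ≤ K * τ →
      Integrable (fun ω => |S ω| ^ k) μ → Integrable (fun ω => |T ω| ^ k) μ →
      ∫ ω, |S ω| ^ k ∂μ ≤ M → ∫ ω, |T ω| ^ k ∂μ ≤ M →
      HasLaw ZS (gaussianReal 0 τ) μ → HasLaw ZT (gaussianReal 0 τ) μ →
      IndepFun (fun ω => (S ω, T ω)) (fun ω => (ZS ω, ZT ω)) μ → IndepFun ZS ZT μ →
      ∀ β : ℝ, 0 ≤ β → β ≤ 1 →
        HasFiniteFisherInfo μ (S + ZS) ∧ HasFiniteFisherInfo μ (T + ZT) ∧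
        HasFiniteFisherInfo μ (mix β (S + ZS) (T + ZT)) ∧
        Integrable (scoreGapSq μ (S + ZS) (T + ZT) β) μ ∧
        β * fisherInfo μ (S + ZS) + (1 - β) * fisherInfo μ (T + ZT)
            - fisherInfo μ (mix β (S + ZS) (T + ZT))
            + C * alphaMixing μ S T ^ (k / (k + 4) - ε)
          ≥ scoreGap μ (S + ZS) (T + ZT) β) := by

  refine ⟨?_, fun k M hk => ?_⟩
  -- The variance is the second moment about the mean, and 2/(2 + 4) = 1/3.
  · obtain ⟨C, hC⟩ := exists_scoreGap_const hτ hε one_lt_two (K * τ)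
    refine ⟨C, fun Ω _ μ _ S T ZS ZT mS mT mZS mZT hS hT hv lS lT hi hiZ β h0 h1 => ?_⟩
    rw [show (1 : ℝ) / 3 = 2 / (2 + 4) by norm_num]
    have key : ∀ U : Ω → ℝ, MemLp U 2 μ → variance U μ ≤ K * τ →
        Integrable (fun ω => |U ω - ∫ ω, U ω ∂μ| ^ (2 : ℝ)) μ ∧
        ∫ ω, |U ω - ∫ ω, U ω ∂μ| ^ (2 : ℝ) ∂μ ≤ K * τ := fun U hU hUv => by
      simp only [Real.rpow_two, sq_abs]
      refine ⟨(hU.sub (memLp_const _)).integrable_sq, ?_⟩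
      rwa [← variance_eq_integral hU.aestronglyMeasurable.aemeasurable]
    obtain ⟨iS, bS⟩ := key S hS ((le_max_left _ _).trans hv)
    obtain ⟨iT, bT⟩ := key T hT ((le_max_right _ _).trans hv)
    exact hC Ω μ S T ZS ZT ⟨mS, mT, mZS, mZT, lS, lT, hi, hiZ⟩ _ _ iS iT bS bT β h0 h1
  · obtain ⟨C, hC⟩ := exists_scoreGap_const hτ hε (one_lt_two.trans_le hk) M
    refine ⟨C, fun Ω _ μ _ S T ZS ZT mS mT mZS mZT _ _ _ iS iT bS bT lS lT hi hiZ β h0 h1 => ?_⟩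
    exact hC Ω μ S T ZS ZT ⟨mS, mT, mZS, mZT, lS, lT, hi, hiZ⟩ 0 0 (by simpa using iS)
      (by simpa using iT) (by simpa using bS) (by simpa using bT) β h0 h1
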